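/- **Ground field.** Let $k$ be a field, $\mathbb K=k(q_1,\dots,q_v)$ a rational function field ($v\ge 0$), and let $\mathbb G$ be one of $\mathbb K(x)$ (rational), $\mathbb K(x_1,\dots,x_v)$ (multibasic), $\mathbb K(x,x_1,\dots,x_v)$ (mixed multibasic), with the field automorphism $\sigma$ given by $\sigma|_{\mathbb K}=\mathrm{id}$, $\sigma(x)=x+1$, $\sigma(x_j)=q_jx_j$. In the rational and the mixed case $k$ has characteristic $0$. For coprime polynomials $p,q$ and $f=p/q\in\mathbb G$ put $\operatorname{ev}(f,n)=p(n,q_1^n,\dots,q_v^n)/q(n,q_1^n,\dots,q_v^n)$, and $\operatorname{ev}(f,n)=0$ if the denominator vanishes. Let $L(f)$ be the least $\delta\ge 0$ such that $q(n,q_1^n,\dots,q_v^n)\ne0$ for all $n\ge\delta$, and for $f\neq 0$ let $Z(f)=\max(L(1/p),L(1/q))$. **Extension.** Let $(\mathbb E,\sigma)$ be a basic $APS$-extension of $(\mathbb G,\sigma)$: $\sigma$ is extended to an automorphism of the commutative ring $\mathbb E=\mathbb G\langle t_1\rangle\dots\langle t_e\rangle$, which is the last ring of a tower $\mathbb G=\mathbb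 A_0\le\dots\le\mathbb A_e=\mathbb E$, where for each $i$ one of the following holds: (A) $\mathbb A_i=\mathbb A_{i-1}[t_i]$ subject only to the relation $t_i^{\nu}=1$ with $\nu>1$, and $\sigma(t_i)=\alpha_it_i$ with a primitive $\nu$-th root of unity $\alpha_i\in\mathbb G^*$, $\sigma(\alpha_i)=\alpha_i$; (P) $\mathbb A_i=\mathbb A_{i-1}[t_i,t_i^{-1}]$ is a Laurent polynomial ring and $\sigma(t_i)=\alpha_it_i$, where $\alpha_i$ is the product of an element of $\mathbb G^*$ and of integer powers of $P$-monomials $t_j$ with $j<i$; (S) $\mathbb A_i=\mathbb A_{i-1}[t_i]$ is a polynomial ring and $\sigma(t_i)=t_i+\beta_i$ with $\beta_i\in\mathbb A_{i-1}$. Every $f\in\mathbb E$ has a unique reduced representation $f=\sum_m f_m t_1^{m_1}\cdots t_e^{m_e}$ with $f_m\in\mathbb G$, where $0\le m_i<\nu$, $m_i\in\mathbb Z$, $m_i\geq 0$ for an $A$-monomial of order $\nu$, a $P$-monomial and an $S$-monomial $t_i$, respectively. **Evaluation.** Let lower bounds $l_1,\dots,l_e\in\mathbb Z_{\ge0}$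 be given. Put $\operatorname{ev}(f,n)=\sum_m\operatorname{ev}(f_m,n)\prod_i\operatorname{ev}(t_i,n)^{m_i}$ with $\operatorname{ev}(t_i,n)=\prod_{k=l_i}^n\operatorname{ev}(\sigma^{-1}(\alpha_i),k)$ for an $A$- or $P$-monomial and $\operatorname{ev}(t_i,n)=\sum_{k=l_i}^n\operatorname{ev}(\sigma^{-1}(\beta_i),k)$ for an $S$-monomial. Let $L(f)$ be the maximum of $0$, of all $L(f_m)$ with $f_m\neq0$, and of all $l_j-1$ with $t_j$ occurring in $f$; let $Z(h\,t_1^{m_1}\cdots t_e^{m_e})=Z(h)$ for $h\in\mathbb G^*$. Suppose that $l_i=1$ for an $A$-monomial, $l_i\ge\max(L(\sigma^{-1}(\alpha_i)),Z(\sigma^{-1}(\alpha_i)))$ for a $P$-monomial, and $l_i\ge L(\sigma^{-1}(\beta_i))$ for an $S$-monomial. Let $S(\mathbb K)$ be the ring of sequences over $\mathbb K$ modulo equality from some point on, with the shift $S$, and let $\tau:\mathbb E\to S(\mathbb K)$, $\tau(f)=(\operatorname{ev}(f,n))_{n\ge0}$. **Expressions.** $\mathrm{Prod}^*(\mathbb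 G)$ is the smallest set of formal expressions that contains $1$ and $\mathrm{RPow}(r)$ for all roots of unity $r\in\mathbb K\setminus\{1\}$, is closed under $\odot$ and under nonzero integer powers, and contains $\mathrm{Prod}(l,f\odot p)$ whenever $p\in\mathrm{Prod}^*(\mathbb G)$, $f\in\mathbb G^*$, $l\ge Z(f)$. $\mathrm{SumProd}(\mathbb G)$ is the smallest set that contains $\mathbb G\cup\mathrm{Prod}^*(\mathbb G)$ and is closed under $\oplus$, $\odot$, positive integer powers, and $F\mapsto\mathrm{Sum}(l,F)$ for $l\ge0$. $\Sigma\Pi(\mathbb G)$ consists of all these $\mathrm{RPow}(r)$, $\mathrm{Prod}(l,f\odot p)$, and of all $\mathrm{Sum}(l,F)$ with $F\in\mathrm{SumProd}(\mathbb G)$. Expressions are evaluated by $\mathrm{RPow}(r)(n)=r^n$, $\mathrm{Sum}(l,F)(n)=\sum_{i=l}^nF(i)$, $\mathrm{Prod}(l,F)(n)=\prod_{i=l}^nF(i)$, by $\operatorname{ev}$ on $\mathbb G$, and by interpreting $\oplus$, $\odot$ and powers in $\mathbb K$. For $W\subseteq\Sigma\Pi(\mathbb G)$, $\mathrm{SumProd}(W,\mathbb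 G)$ is the set of expressions $(f_1\odot P_1)\oplus\dots\oplus(f_r\odot P_r)$, $r\geq0$ (the expression $0$ if $r=0$), with $f_i\in\mathbb G^*$ and $P_i=a_{i,1}^{z_{i,1}}\odot\dots\odot a_{i,n_i}^{z_{i,n_i}}$ ($P_i=1$ if $n_i=0$), where $a_{i,1},\dots,a_{i,n_i}\in W$ are pairwise distinct, where $z_{i,j}\ge1$ for a sum, $z_{i,j}\ne0$ for a product, $1\le z_{i,j}<\mathrm{ord}(r)$ for $\mathrm{RPow}(r)$, and where no two of $P_1,\dots,P_r$ agree up to a permutation of their factors. $W$ is *canonical reduced* over $\mathbb G$ if any $A,B\in\mathrm{SumProd}(W,\mathbb G)$ with $A(n)=B(n)$ for all sufficiently large $n$ are the same up to permutations of the operands of $\oplus$ and $\odot$ (with the elements of $W$ regarded as atoms). For $1\le i\le e$ let $T_i=\mathrm{expr}(t_i)$, defined recursively: $\mathrm{RPow}(\alpha_i)$, $\mathrm{Prod}(l_i,F)$ or $\mathrm{Sum}(l_i,F)$ for an $A$-, $P$- or $S$-monomial, where $F$ results from the reduced representation of $\sigma^{-1}(\alpha_i)$ or $\sigma^{-1}(\beta_i)$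 (its terms listed in a fixed order) by replacing each $t_j$ with $T_j$, $+$ with $\oplus$ and $\cdot$ with $\odot$. Let $W=\{T_1,\dots,T_e\}$. **Theorem.** $\tau$ is a $\mathbb K$-homomorphism (a ring homomorphism with $\tau\circ\sigma=S\circ\tau$ and $\tau(c)=(c,c,\dots)$ for $c\in\mathbb K$), and $T_i\in\Sigma\Pi(\mathbb G)$ for all $i$. Consider the statements: 1. $(\mathbb E,\sigma)$ is an $R\Pi\Sigma$-extension of $(\mathbb G,\sigma)$, i.e. $\{c\in\mathbb E\mid\sigma(c)=c\}=\{c\in\mathbb G\mid\sigma(c)=c\}$. 2. $\tau$ is a $\mathbb K$-isomorphism between $(\mathbb E,\sigma)$ and $(\tau(\mathbb E),S)$; moreover the sequences $\tau(t_i)$ of the $P$- and $S$-monomials are algebraically independent over the ring generated by $\tau(\mathbb G)$ and the sequences $\tau(t_i)$ of the $A$-monomials. 3. $W$ is canonical reduced over $\mathbb G$. 4. Zero recognition is trivial: for every $F\in\mathrm{SumProd}(W,\mathbb G)$, $F=0$ (as an expression) if and only if $F(n)=0$ for all sufficiently large $n$. Then (1) and (2) are equivalent, and they imply that $T_1,\dots,T_e$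 are pairwise distinct. If $T_1,\dots,T_e$ are pairwise distinct, then (1), (2), (3) and (4) are equivalent. -/

import Mathlib

noncomputable section

namespace SymbolicSummation

open Polynomial

/-! ### The ground fields -/

/-- The three types of ground fields over `K`: `K(x)`, `K(x_1, …, x_v)`, `K(x, x_1, …, x_v)`. -/
inductive GroundKind
  | rational
  | multibasic
  | mixed

/-- The variables present in each case; `none` stands for `x`, and `some j` for `x_j`. -/
def GroundKind.HasVar {v : ℕ} : GroundKind → Option (Fin v) → Prop
  | .rational, i => i = none
  | .multibasic, i => i ≠ none
  | .mixed, _ => True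

abbrev GroundKind.Vars (kd : GroundKind) (v : ℕ) : Type :=
  {i : Option (Fin v) // kd.HasVar i}

section Ground

variable (kd : GroundKind) {K : Type*} [Field K] {v : ℕ} (q : Fin v → Kˣ)

/-- The polynomial ring whose field of fractions is the ground field. -/
abbrev GroundPoly (kd : GroundKind) (K : Type*) [Field K] (v : ℕ) : Type _ :=
  MvPolynomial (kd.Vars v) K

/-- The rational function field `K(x)`, `K(x_1, …, x_v)` or `K(x, x_1, …, x_v)`. -/
abbrev GroundField (kd : GroundKind) (K : Type*) [Field K] (v : ℕ) : Type _ :=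
  FractionRing (GroundPoly kd K v)

/-- The point `(n, q_1 ^ n, …, q_v ^ n)`. -/
def evalPoint (n : ℕ) (i : kd.Vars v) : K :=
  match i.1 with
  | none => (n : K)
  | some j => (q j : K) ^ n

/-- `p(n, q_1 ^ n, …, q_v ^ n)` for a polynomial `p`. -/
def polyEval (p : GroundPoly kd K v) (n : ℕ) : K :=
  MvPolynomial.eval (evalPoint kd q n) p

/-- The evaluation of a rational function in lowest terms; it is `0` at a pole. -/
def groundEval (f : GroundField kd K v) (n : ℕ) : K :=
  open Classical in
  if polyEval kd q (IsFractionRing.den (GroundPoly kd K v) f : GroundPoly kd K v) n = 0 then 0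
  else polyEval kd q (IsFractionRing.num (GroundPoly kd K v) f) n /
    polyEval kd q (IsFractionRing.den (GroundPoly kd K v) f : GroundPoly kd K v) n

/-- The least `δ` with `p(n, q_1 ^ n, …, q_v ^ n) ≠ 0` for all `n ≥ δ`. -/
def nonzeroFrom (p : GroundPoly kd K v) : ℕ :=
  sInf {δ : ℕ | ∀ n, δ ≤ n → polyEval kd q p n ≠ 0}

/-- The `o`-function `L` of the ground field: no poles from `L(f)` on. -/
def groundL (f : GroundField kd K v) : ℕ :=
  nonzeroFrom kd q (IsFractionRing.den (GroundPoly kd K v) f : GroundPoly kd K v)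

/-- The `z`-function `Z(p / q) = max(L(1 / p), L(1 / q))` of the ground field. -/
def groundZ (f : GroundField kd K v) : ℕ :=
  max (nonzeroFrom kd q (IsFractionRing.num (GroundPoly kd K v) f))
    (nonzeroFrom kd q (IsFractionRing.den (GroundPoly kd K v) f : GroundPoly kd K v))

/-- The image `x + 1` of `x` and `q_j x_j` of `x_j`. -/
def shiftVar (i : kd.Vars v) : GroundPoly kd K v :=
  match i.1 with
  | none => MvPolynomial.X i + 1
  | some j => MvPolynomial.C (q j : K) * MvPolynomial.X i

/-- The preimage `x - 1` of `x` and `q_j⁻¹ x_j` of `x_j`. -/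
def unshiftVar (i : kd.Vars v) : GroundPoly kd K v :=
  match i.1 with
  | none => MvPolynomial.X i - 1
  | some j => MvPolynomial.C ((q j)⁻¹ : Kˣ).val * MvPolynomial.X i

theorem aeval_unshiftVar_shiftVar (i : kd.Vars v) :
    MvPolynomial.aeval (unshiftVar kd q) (shiftVar kd q i) = MvPolynomial.X i := by
  obtain ⟨i, hi⟩ := i
  cases i with
  | none => simp [shiftVar, unshiftVar]
  | some j =>
    simp only [shiftVar, unshiftVar, map_mul, MvPolynomial.aeval_X, MvPolynomial.algHom_C,
      MvPolynomial.algebraMap_eq]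
    rw [← mul_assoc, ← MvPolynomial.C_mul]
    simp

theorem aeval_shiftVar_unshiftVar (i : kd.Vars v) :
    MvPolynomial.aeval (shiftVar kd q) (unshiftVar kd q i) = MvPolynomial.X i := by
  obtain ⟨i, hi⟩ := i
  cases i with
  | none => simp [shiftVar, unshiftVar]
  | some j =>
    simp only [shiftVar, unshiftVar, map_mul, MvPolynomial.aeval_X, MvPolynomial.algHom_C,
      MvPolynomial.algebraMap_eq]
    rw [← mul_assoc, ← MvPolynomial.C_mul]
    simp

/-- The `K`-automorphism of the polynomial ring with `x ↦ x + 1` and `x_j ↦ q_j x_j`. -/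
def polyShift : GroundPoly kd K v ≃ₐ[K] GroundPoly kd K v :=
  AlgEquiv.ofAlgHom (MvPolynomial.aeval (shiftVar kd q)) (MvPolynomial.aeval (unshiftVar kd q))
    (by
      apply MvPolynomial.algHom_ext
      intro i
      rw [AlgHom.comp_apply, MvPolynomial.aeval_X, aeval_shiftVar_unshiftVar]
      rfl)
    (by
      apply MvPolynomial.algHom_ext
      intro i
      rw [AlgHom.comp_apply, MvPolynomial.aeval_X, aeval_unshiftVar_shiftVar]
      rfl)

/-- The automorphism `σ` of the ground field with `x ↦ x + 1`, `x_j ↦ q_j x_j`, identity on `K`. -/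
def groundShift : GroundField kd K v ≃+* GroundField kd K v :=
  IsFractionRing.ringEquivOfRingEquiv (polyShift kd q).toRingEquiv

end Ground

/-! ### APS-extensions -/

/-- The three types of monomials; `A ν` is an `A`-monomial of order `ν`. -/
inductive MonomialKind
  | A (ν : ℕ)
  | P
  | S

/-- The exponents that occur in a reduced representation. -/
def MonomialKind.exponents : MonomialKind → Set ℤ
  | .A ν => {z | 0 ≤ z ∧ z < (ν : ℤ)}
  | .P => Set.univ
  | .S => {z | 0 ≤ z}

/-- Integer powers in a commutative ring (meant for units if the exponent is negative). -/
def ringZPow {E : Type*} [CommRing E] (x : E) : ℤ → E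
  | .ofNat n => x ^ n
  | .negSucc n => Ring.inverse x ^ (n + 1)

/-- One step `B = A⟨t⟩` of a tower of subrings of `E`, where `σ(t) = α t + β`:
* `A`-monomial of order `ν`: `B = A[t]` is `A[X] / (X ^ ν - 1)`, and `σ(t) / t ∈ A` is a primitive
  `ν`-th root of unity;
* `P`-monomial: `B = A[t, t⁻¹]` is a Laurent polynomial ring and `σ(t) / t` is a unit of `A`;
* `S`-monomial: `B = A[t]` is a polynomial ring and `σ(t) - t ∈ A`. -/
def IsAPSStep {E : Type*} [CommRing E] (A B : Subring E) (t α β : E) : MonomialKind → Prop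
  | .A ν =>
      1 < ν ∧ B = Subring.closure ((A : Set E) ∪ {t}) ∧
      RingHom.ker (aeval (R := A) t : A[X] →ₐ[A] E) = Ideal.span {X ^ ν - 1} ∧
      α ∈ A ∧ IsPrimitiveRoot α ν ∧ β = 0
  | .P =>
      (∃ u : Eˣ, (u : E) = t ∧ B = Subring.closure ((A : Set E) ∪ {t, ((u⁻¹ : Eˣ) : E)})) ∧
      Function.Injective (aeval (R := A) t : A[X] →ₐ[A] E) ∧
      (∃ a : Aˣ, ((a : A) : E) = α) ∧ β = 0
  | .S =>
      B = Subring.closure ((A : Set E) ∪ {t}) ∧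
      Function.Injective (aeval (R := A) t : A[X] →ₐ[A] E) ∧
      α = 1 ∧ β ∈ A

/-- An APS-extension `E = G⟨t_1⟩…⟨t_e⟩` of a difference field `(G, σ₀)`, given by the automorphism
`shift` of `E` which extends `σ₀`, the tower of subrings `G = A_0 ≤ A_1 ≤ … ≤ A_e = E`, and the
monomials `t_i` with `σ(t_i) = α_i t_i + β_i`. -/
structure APSExtension {G : Type*} [Field G] (σ₀ : G ≃+* G) (E : Type*) [CommRing E] [Algebra G E]
    (e : ℕ) where
  shift : E ≃+* E
  tower : Fin (e + 1) → Subring E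
  t : Fin e → E
  α : Fin e → E
  β : Fin e → E
  kind : Fin e → MonomialKind
  algebraMap_injective : Function.Injective (algebraMap G E)
  shift_algebraMap : ∀ a : G, shift (algebraMap G E a) = algebraMap G E (σ₀ a)
  tower_zero : tower 0 = (algebraMap G E).range
  tower_last : tower (Fin.last e) = ⊤
  shift_t : ∀ i, shift (t i) = α i * t i + β i
  step : ∀ i : Fin e, IsAPSStep (tower i.castSucc) (tower i.succ) (t i) (α i) (β i) (kind i)

/-- The constants of a difference ring. -/
def constants {R : Type*} [CommRing R] (σ : R ≃+* R) : Set R := {c | σ c = c}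

namespace APSExtension

section General

variable {G : Type*} [Field G] {σ₀ : G ≃+* G} {E : Type*} [CommRing E] [Algebra G E] {e : ℕ}
  (X : APSExtension σ₀ E e)

/-- A basic extension: for a `P`-monomial, `σ(t_i) / t_i` is a product of some `h ∈ G^*` and of
integer powers of `P`-monomials `t_j` with `j < i`; for an `A`-monomial, `σ(t_i) / t_i` is a
constant of `G^*`. -/
def IsBasic : Prop :=
  ∀ i, match X.kind i with
    | .A _ => ∃ a : G, a ≠ 0 ∧ σ₀ a = a ∧ X.α i = algebraMap G E a
    | .P => ∃ (h : G) (m : Fin e → ℤ), h ≠ 0 ∧ (∀ j, m j ≠ 0 → j < i ∧ X.kind j = .P) ∧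
        X.α i = algebraMap G E h * ∏ j, ringZPow (X.t j) (m j)
    | .S => True

/-- An `RΠΣ`-extension: no new constants. -/
def IsRPiSigma : Prop :=
  constants X.shift = algebraMap G E '' constants σ₀

/-- `c` is a reduced representation `∑_m c_m t_1 ^ m_1 ⋯ t_e ^ m_e` of `f`. -/
def IsReducedRep (f : E) (c : (Fin e → ℤ) →₀ G) : Prop :=
  (∀ m ∈ c.support, ∀ i, m i ∈ (X.kind i).exponents) ∧
  f = c.sum fun m a => algebraMap G E a * ∏ i, ringZPow (X.t i) (m i)

/-- The (unique) reduced representation of `f`. -/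
def reducedRep (f : E) : (Fin e → ℤ) →₀ G :=
  Classical.epsilon (X.IsReducedRep f)

end General

end APSExtension

/-! ### The term algebra -/

/-- The expressions built from the elements of `G` by the operations `RPow`, `⊕`, `⊙`, powers,
`Sum` and `Prod`. -/
inductive SPExpr (G K : Type*)
  | elem (g : G)
  | rpow (r : K)
  | add (a b : SPExpr G K)
  | mul (a b : SPExpr G K)
  | pow (a : SPExpr G K) (z : ℤ)
  | sum (l : ℕ) (a : SPExpr G K)
  | prod (l : ℕ) (a : SPExpr G K)

/-- The nontrivial roots of unity. -/
def nontrivialRootsOfUnity (K : Type*) [Field K] : Set K :=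
  {r | r ≠ 1 ∧ ∃ n : ℕ, 1 ≤ n ∧ r ^ n = 1}

namespace SPExpr

section Build

variable {G K : Type*} [Field G]

/-- `a_1 ⊕ a_2 ⊕ ⋯ ⊕ a_r`, bracketed to the left; the empty sum is `0`. -/
def addList : List (SPExpr G K) → SPExpr G K
  | [] => elem 0
  | a :: L => L.foldl add a

/-- `a_1 ⊙ a_2 ⊙ ⋯ ⊙ a_r`, bracketed to the left; the empty product is `1`. -/
def mulList : List (SPExpr G K) → SPExpr G K
  | [] => elem 1
  | a :: L => L.foldl mul a

/-- The expression `(f_1 ⊙ P_1) ⊕ ⋯ ⊕ (f_r ⊙ P_r)` with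
`P_i = (a_{i,1} ^ z_{i,1}) ⊙ ⋯ ⊙ (a_{i,n_i} ^ z_{i,n_i})`, given by the list of the pairs of `f_i`
and the list of the pairs `(a_{i,j}, z_{i,j})`. -/
def ofData (D : List (G × List (SPExpr G K × ℤ))) : SPExpr G K :=
  addList (D.map fun x => mul (elem x.1) (mulList (x.2.map fun y => pow y.1 y.2)))

/-- Two such lists agree up to permutations of the operands of `⊕` and of `⊙`. -/
def DataPerm (D D' : List (G × List (SPExpr G K × ℤ))) : Prop :=
  ∃ D'', D.Perm D'' ∧ List.Forall₂ (fun x y => x.1 = y.1 ∧ x.2.Perm y.2) D'' D'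

/-- `A` and `B` are the same up to permutations of the operands of `⊕` and of `⊙`. -/
def SameUpToPerm (A B : SPExpr G K) : Prop :=
  ∃ D D', A = ofData D ∧ B = ofData D' ∧ DataPerm D D'

end Build

variable (kd : GroundKind) {K : Type*} [Field K] {v : ℕ} (q : Fin v → Kˣ)

/-- The evaluation `A(n)` of an expression. -/
def eval : SPExpr (GroundField kd K v) K → ℕ → K
  | elem g, n => groundEval kd q g n
  | rpow r, n => r ^ n
  | add a b, n => eval a n + eval b n
  | mul a b, n => eval a n * eval b n
  | pow a z, n => eval a n ^ z
  | sum l a, n => ∑ i ∈ Finset.Icc l n, eval a i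
  | prod l a, n => ∏ i ∈ Finset.Icc l n, eval a i

/-- The set `Prod^*(G)` of power products of nested products. -/
inductive IsProdStar : SPExpr (GroundField kd K v) K → Prop
  | one : IsProdStar (elem 1)
  | rpow (r : K) : r ∈ nontrivialRootsOfUnity K → IsProdStar (rpow r)
  | prod (l : ℕ) (f : GroundField kd K v) (p : SPExpr (GroundField kd K v) K) :
      IsProdStar p → f ≠ 0 → groundZ kd q f ≤ l → IsProdStar (prod l (mul (elem f) p))
  | mul (p p' : SPExpr (GroundField kd K v) K) :
      IsProdStar p → IsProdStar p' → IsProdStar (mul p p')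
  | pow (p : SPExpr (GroundField kd K v) K) (z : ℤ) :
      IsProdStar p → z ≠ 0 → IsProdStar (pow p z)

/-- The set `SumProd(G)` of expressions in terms of nested sums over nested products. -/
inductive IsSumProd : SPExpr (GroundField kd K v) K → Prop
  | elem (g : GroundField kd K v) : IsSumProd (elem g)
  | prodStar (p : SPExpr (GroundField kd K v) K) : IsProdStar kd q p → IsSumProd p
  | add (a b : SPExpr (GroundField kd K v) K) : IsSumProd a → IsSumProd b → IsSumProd (add a b)
  | mul (a b : SPExpr (GroundField kd K v) K) : IsSumProd a → IsSumProd b → IsSumProd (mul a b)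
  | pow (a : SPExpr (GroundField kd K v) K) (z : ℤ) : IsSumProd a → 1 ≤ z → IsSumProd (pow a z)
  | sum (l : ℕ) (a : SPExpr (GroundField kd K v) K) : IsSumProd a → IsSumProd (sum l a)

/-- The set `ΣΠ(G)` of nested sums and products. -/
def IsSigmaPi : SPExpr (GroundField kd K v) K → Prop
  | rpow r => r ∈ nontrivialRootsOfUnity K
  | sum _ a => IsSumProd kd q a
  | prod l a => ∃ (f : GroundField kd K v) (p : SPExpr (GroundField kd K v) K),
      a = mul (elem f) p ∧ IsProdStar kd q p ∧ f ≠ 0 ∧ groundZ kd q f ≤ l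
  | _ => False

/-- The exponents that are allowed for a sum or product in a reduced representation. -/
def AllowedExponent : SPExpr (GroundField kd K v) K → ℤ → Prop
  | rpow r, z => 1 ≤ z ∧ z < (orderOf r : ℤ)
  | sum _ _, z => 1 ≤ z
  | prod _ _, z => z ≠ 0
  | _, _ => False

/-- The list `D` describes a reduced representation whose sums and products are taken from `W`. -/
def IsReducedData (W : Set (SPExpr (GroundField kd K v) K))
    (D : List (GroundField kd K v × List (SPExpr (GroundField kd K v) K × ℤ))) : Prop :=
  (∀ x ∈ D, x.1 ≠ 0 ∧
    (∀ y ∈ x.2, y.1 ∈ W ∧ IsSigmaPi kd q y.1 ∧ AllowedExponent kd y.1 y.2) ∧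
    (x.2.map Prod.fst).Nodup) ∧
  D.Pairwise fun x x' => ¬ x.2.Perm x'.2

/-- The set `SumProd(W, G)`. -/
def SumProd (W : Set (SPExpr (GroundField kd K v) K)) : Set (SPExpr (GroundField kd K v) K) :=
  {A | ∃ D, IsReducedData kd q W D ∧ A = ofData D}

/-- `W` is canonical reduced over `G`. -/
def IsCanonicalReduced (W : Set (SPExpr (GroundField kd K v) K)) : Prop :=
  ∀ A ∈ SumProd kd q W, ∀ B ∈ SumProd kd q W,
    (∃ δ : ℕ, ∀ n, δ ≤ n → eval kd q A n = eval kd q B n) → SameUpToPerm A B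

/-- Zero recognition in `SumProd(W, G)` is trivial. -/
def TrivialZeroRecognition (W : Set (SPExpr (GroundField kd K v) K)) : Prop :=
  ∀ F ∈ SumProd kd q W, F = elem 0 ↔ ∃ δ : ℕ, ∀ n, δ ≤ n → eval kd q F n = 0

end SPExpr

/-! ### Evaluation and induced expressions in APS-extensions of the ground field -/

namespace APSExtension

variable {kd : GroundKind} {K : Type*} [Field K] {v : ℕ} {q : Fin v → Kˣ}
  {E : Type*} [CommRing E] [Algebra (GroundField kd K v) E] {e : ℕ}
  (X : APSExtension (groundShift kd q) E e) (l : Fin e → ℕ)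

/-- The evaluation `∑_m ev(c_m, n) g_1(n) ^ m_1 ⋯ g_e(n) ^ m_e` of `f = ∑_m c_m t_1 ^ m_1 ⋯ t_e ^ m_e`
(in reduced representation) when the monomial `t_j` is evaluated to `g_j(n)`. -/
def evWith (g : Fin e → ℕ → K) (f : E) (n : ℕ) : K :=
  (X.reducedRep f).sum fun m a => groundEval kd q a n * ∏ j, g j n ^ m j

/-- The evaluation of the monomial `t_i` with the lower bounds `l`; it is defined recursively, as
only the monomials `t_j` with `j < i` occur in `σ⁻¹(α_i)` and `σ⁻¹(β_i)`. -/
def evMonomial (i : Fin e) (n : ℕ) : K :=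
  match X.kind i with
  | .S => ∑ k ∈ Finset.Icc (l i) n,
      X.evWith (fun j k' => if _h : j < i then evMonomial j k' else 1) (X.shift.symm (X.β i)) k
  | _ => ∏ k ∈ Finset.Icc (l i) n,
      X.evWith (fun j k' => if _h : j < i then evMonomial j k' else 1) (X.shift.symm (X.α i)) k
termination_by i

/-- The evaluation function of the extension for the lower bounds `l`. -/
def ev (f : E) (n : ℕ) : K :=
  X.evWith (X.evMonomial l) f n

/-- The `o`-function of the extension: the maximum of the values `L(c_m)` for the coefficients of
the reduced representation of `f` and of the numbers `l_j - 1` for the monomials occurring in `f`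
(which results from iterating `L(∑ f_i t ^ i) = max(l - 1, max_i L(f_i))`). -/
def oFun (f : E) : ℕ :=
  (X.reducedRep f).support.sup fun m =>
    max (groundL kd q (X.reducedRep f m))
      ((Finset.univ.filter fun j => m j ≠ 0).sup fun j => l j - 1)

/-- The `z`-function of the extension, `Z(h t_1 ^ m_1 ⋯ t_e ^ m_e) = Z(h)` for `h ∈ G^*`. -/
def zFun (f : E) : ℕ :=
  (X.reducedRep f).support.sup fun m => groundZ kd q (X.reducedRep f m)

/-- The lower bounds which are admitted in the construction of the evaluation function. -/
def IsLowerBounds : Prop :=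
  ∀ i, match X.kind i with
    | .A _ => l i = 1
    | .P => max (X.oFun l (X.shift.symm (X.α i))) (X.zFun (X.shift.symm (X.α i))) ≤ l i
    | .S => X.oFun l (X.shift.symm (X.β i)) ≤ l i

/-- The expression which results from the reduced representation of `f` by replacing each monomial
`t_j` with `T_j`, `+` with `⊕` and `·` with `⊙`. -/
def exprWith (T : Fin e → SPExpr (GroundField kd K v) K) (f : E) : SPExpr (GroundField kd K v) K :=
  SPExpr.ofData ((X.reducedRep f).support.toList.map fun m =>
    (X.reducedRep f m,
      ((List.finRange e).filter fun j => decide (m j ≠ 0)).map fun j => (T j, m j)))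

/-- The element of `K` that is equal to a given element of `E` (if there is one). -/
def toBase (a : E) : K :=
  Function.invFun
    (fun c : K => algebraMap (GroundField kd K v) E (algebraMap K (GroundField kd K v) c)) a

/-- The induced sum-product expression `T_i = expr(t_i)`. -/
def exprMonomial (i : Fin e) : SPExpr (GroundField kd K v) K :=
  match X.kind i with
  | .A _ => .rpow (toBase (kd := kd) (v := v) (X.α i))
  | .P => .prod (l i)
      (X.exprWith (fun j => if _h : j < i then exprMonomial j else .elem 1)
        (X.shift.symm (X.α i)))
  | .S => .sum (l i)
      (X.exprWith (fun j => if _h : j < i then exprMonomial j else .elem 1)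
        (X.shift.symm (X.β i)))
termination_by i

end APSExtension

/-! ### The ring of sequences -/

/-- The ring of sequences over `K`, where sequences that agree from some point on are identified. -/
abbrev SeqRing (K : Type*) : Type _ := Filter.Germ (Filter.atTop : Filter ℕ) K

/-- The shift `(a_0, a_1, a_2, …) ↦ (a_1, a_2, a_3, …)`. -/
def seqShift {K : Type*} (a : SeqRing K) : SeqRing K :=
  a.compTendsto (fun n : ℕ => n + 1) (Filter.tendsto_add_atTop_nat 1)

namespace APSExtension

variable {kd : GroundKind} {K : Type*} [Field K] {v : ℕ} {q : Fin v → Kˣ}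
  {E : Type*} [CommRing E] [Algebra (GroundField kd K v) E] {e : ℕ}
  (X : APSExtension (groundShift kd q) E e) (l : Fin e → ℕ)

/-- The map `τ(f) = (ev(f, n))_{n ≥ 0}`. -/
def tau (f : E) : SeqRing K := ((X.ev l f : ℕ → K) : SeqRing K)

/-- `τ` is a `K`-homomorphism. -/
def TauIsKHom : Prop :=
  ∃ φ : E →+* SeqRing K, (∀ f, φ f = X.tau l f) ∧
    (∀ f, φ (X.shift f) = seqShift (φ f)) ∧
    ∀ c : K, φ (algebraMap (GroundField kd K v) E (algebraMap K (GroundField kd K v) c)) =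
      ((fun _ => c : ℕ → K) : SeqRing K)

/-- `τ` is a `K`-isomorphism between `(E, σ)` and `(τ(E), S)`. -/
def TauIsKIso : Prop :=
  ∃ (R : Subring (SeqRing K)) (φ : E ≃+* R), (R : Set (SeqRing K)) = Set.range (X.tau l) ∧
    (∀ f, (φ f : SeqRing K) = X.tau l f) ∧
    (∀ f, (φ (X.shift f) : SeqRing K) = seqShift (φ f : SeqRing K)) ∧
    ∀ c : K, (φ (algebraMap (GroundField kd K v) E (algebraMap K (GroundField kd K v) c)) :
      SeqRing K) = ((fun _ => c : ℕ → K) : SeqRing K)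

/-- The ring `τ(G)[τ(ρ_1), …, τ(ρ_s)]` where `ρ_1, …, ρ_s` are the `A`-monomials. -/
def rootRing : Subring (SeqRing K) :=
  Subring.closure
    (Set.range (fun g : GroundField kd K v => X.tau l (algebraMap (GroundField kd K v) E g)) ∪
      {s | ∃ i ν, X.kind i = .A ν ∧ s = X.tau l (X.t i)})

/-- The sequences of the `P`- and `S`-monomials are algebraically independent over the ring of the
sequences of `G` and of the `A`-monomials. -/
def MonomialsAlgIndep : Prop :=
  AlgebraicIndependent (X.rootRing l)
    (fun i : {i : Fin e // ∀ ν, X.kind i ≠ .A ν} => X.tau l (X.t i.1))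

end APSExtension

end SymbolicSummation

end

open SymbolicSummation

noncomputable section

namespace SymbolicSummation

open Polynomial

/-! ### The ground field -/

section Nonvanishing

/-! Everything is governed by the kernel of τ. Nonzero polynomials do not vanish at (n, q_1^n, …,
q_v^n) for large n (`exists_forall_polyEval_ne_zero`), so evaluation is a homomorphism from G to the
ring of sequences. The power products with reduced exponents form a G-basis of E (`powerBasis`), and
the sequences attached to the monomials satisfy the relations of the monomials. Hence the
homomorphism extends to E; the extension is τ, and it commutes with the shifts (`exists_tauHom`).

Statement (1) is equivalent to injectivity of τ. The kernel is a σ-invariant ideal without 1. If E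
has no constants beyond those of G, an induction along the tower shows that 0 and E are the only
invariant ideals (`IsAPSStep.isShiftSimple`, `isShiftSimple_tower`), so the kernel is 0. Conversely,
the sequence of a constant of E is shift-invariant, hence constant from some point on, hence the
image of some c in K; injectivity identifies the constant with c (`isRPiSigma_of_injective`).

The other statements rephrase injectivity. An injective τ carries the basis property over to
algebraic independence of the sequences (`monomialsAlgIndep_of_injective`). If the T_i are distinct,
reduced expressions over W up to permutation correspond to reduced representations of elements of E,
with the same values (`exists_dataPerm_repData`, `eval_ofData_repData`). So injectivity gives
canonical reducedness, whose special case of comparison with 0 is zero recognition, and zero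
recognition says that the kernel is 0. Distinctness itself follows from injectivity, because T_i =
T_j forces τ(t_i) = τ(t_j). -/

theorem exists_forall_eval_natCast_ne_zero {k : Type*} [Field k] (c : k[X]) (hc : c ≠ 0)
    (h : CharZero k ∨ c.natDegree = 0) : ∃ N : ℕ, ∀ n, N ≤ n → c.eval (n : k) ≠ 0 := by
  rcases h with h | h
  · have hfin : {n : ℕ | c.eval (n : k) = 0}.Finite := by
      have := (Polynomial.finite_setOfPred_isRoot hc).preimage
        (f := fun n : ℕ => (n : k)) (Nat.cast_injective.injOn)
      exact this
    obtain ⟨N, hN⟩ := hfin.bddAbove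
    refine ⟨N + 1, fun n hn h0 => ?_⟩
    have : n ≤ N := hN h0
    omega
  · refine ⟨0, fun n _ => ?_⟩
    rw [Polynomial.eq_C_of_natDegree_eq_zero h] at hc ⊢
    simpa using hc

/-- A finite sum `∑ C_u n ^ (u none) X ^ (n u')` of polynomials does not vanish for large `n`. -/
theorem exists_forall_sum_monomial_ne_zero {k : Type*} [Field k] {v : ℕ}
    (s : Finset (Option (Fin v) →₀ ℕ)) (C : (Option (Fin v) →₀ ℕ) → MvPolynomial (Fin v) k)
    (hs : s.Nonempty) (hC : ∀ u ∈ s, C u ≠ 0) (h : CharZero k ∨ ∀ u ∈ s, u none = 0) :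
    ∃ N : ℕ, ∀ n, N ≤ n →
      ∑ u ∈ s, C u * MvPolynomial.monomial (n • u.some) ((n : k) ^ u none) ≠ 0 := by
  classical
  obtain ⟨u0, hu0⟩ := hs
  obtain ⟨a0, ha0⟩ := MvPolynomial.support_nonempty.mpr (hC u0 hu0)
  -- For large `n` the coefficient at `a0 + n • u0.some` only receives contributions from those `u`
  -- with `u.some = u0.some`, and these add up to `c.eval n`. The polynomial `c` is nonzero because
  -- such `u` have distinct entries at `none`.
  set c : k[X] := ∑ u ∈ s.filter (fun u => u.some = u0.some),
    Polynomial.monomial (u none) ((C u).coeff a0) with hcdef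
  have hc : c ≠ 0 := by
    intro h0
    have h1 : c.coeff (u0 none) = (C u0).coeff a0 := by
      rw [hcdef, Polynomial.finsetSum_coeff, Finset.sum_eq_single u0]
      · simp
      · intro u hu hne
        rw [Polynomial.coeff_monomial, if_neg]
        intro h2
        apply hne
        ext o
        cases o with
        | none => exact h2
        | some j => exact DFunLike.congr_fun (Finset.mem_filter.mp hu).2 j
      · intro hn
        simp [hu0] at hn
    rw [h0] at h1
    exact (MvPolynomial.mem_support_iff.mp ha0) (by simpa using h1.symm)
  obtain ⟨N, hN⟩ := exists_forall_eval_natCast_ne_zero c hc (by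
    rcases h with h | h
    · exact Or.inl h
    · right
      rw [Polynomial.natDegree_eq_zero]
      refine ⟨∑ u ∈ s.filter (fun u => u.some = u0.some), (C u).coeff a0, ?_⟩
      rw [hcdef, map_sum]
      refine Finset.sum_congr rfl fun u hu => ?_
      rw [h u (Finset.mem_filter.mp hu).1, Polynomial.monomial_zero_left])
  set M : ℕ := s.sup fun u => Finset.univ.sup fun j => MvPolynomial.degreeOf j (C u) with hM
  have hdeg : ∀ u ∈ s, ∀ m, (C u).coeff m ≠ 0 → ∀ j, m j ≤ M := by
    intro u hu m hm j
    refine (MvPolynomial.monomial_le_degreeOf j (MvPolynomial.mem_support_iff.mpr hm)).trans ?_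
    refine le_trans ?_ (Finset.le_sup (f := fun u => Finset.univ.sup fun j =>
      MvPolynomial.degreeOf j (C u)) hu)
    exact Finset.le_sup (f := fun j => MvPolynomial.degreeOf j (C u)) (Finset.mem_univ j)
  refine ⟨max N (M + 1), fun n hn h0 => hN n (le_trans (le_max_left _ _) hn) ?_⟩
  have hnM : M < n := lt_of_lt_of_le (Nat.lt_succ_self M) (le_trans (le_max_right _ _) hn)
  have h1 := congrArg (MvPolynomial.coeff (a0 + n • u0.some)) h0
  rw [MvPolynomial.coeff_sum, MvPolynomial.coeff_zero] at h1
  rw [hcdef, Polynomial.eval_finsetSum, Finset.sum_filter]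
  refine Eq.trans ?_ h1
  refine Finset.sum_congr rfl fun u hu => ?_
  rw [MvPolynomial.coeff_mul_monomial']
  split_ifs with h2 h3 h3
  · rw [h2, add_tsub_cancel_right, Polynomial.eval_monomial]
  · exact absurd (h2 ▸ le_add_self) h3
  -- If `u` and `u0` differ at `j`, then `n * u.some j` and `n * u0.some j` differ by at least `n >
  -- M`, while the exponents of `C u` and `C u0` are at most `M`; so no monomial of `C u` can land
  -- on the chosen one.
  · by_contra hne
    have hne' : (C u).coeff (a0 + n • u0.some - n • u.some) ≠ 0 := by
      intro h4; rw [h4, zero_mul] at hne; exact hne rfl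
    have hd := hdeg u hu _ hne'
    have ha := hdeg u0 hu0 a0 (MvPolynomial.mem_support_iff.mp ha0)
    obtain ⟨j, hj⟩ : ∃ j, u.some j ≠ u0.some j := by
      by_contra! h5
      exact h2 (Finsupp.ext h5)
    have hd := hd j
    have ha := ha j
    have h3 := h3 j
    simp only [Finsupp.coe_add, Finsupp.coe_smul, Pi.add_apply, Pi.smul_apply, smul_eq_mul,
      Finsupp.coe_tsub, Pi.sub_apply] at hd h3
    rcases lt_or_gt_of_ne hj with h6 | h6
    · have : n * (u.some j + 1) ≤ n * u0.some j := Nat.mul_le_mul_left n h6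
      rw [mul_add] at this
      omega
    · have : n * (u0.some j + 1) ≤ n * u.some j := Nat.mul_le_mul_left n h6
      rw [mul_add] at this
      omega
  · rfl

variable {k K : Type*} [Field k] [Field K] [Algebra k K] {v : ℕ}

/-- `K` is the fraction field of the polynomial ring `k[q_1, …, q_v]`. Once the denominators of the
coefficients of `p` are cleared by `D`, the value of `p` becomes the image of a sum as in
`exists_forall_sum_monomial_ne_zero`: the power `q_j ^ n` is the monomial `X_j ^ n`. -/
theorem exists_forall_eval_option_ne_zero (q : Fin v → Kˣ)
    (hq : AlgebraicIndependent k (fun i => (q i : K)))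
    (hK : IntermediateField.adjoin k (Set.range fun i => (q i : K)) = ⊤)
    (p : MvPolynomial (Option (Fin v)) K) (hp : p ≠ 0)
    (h : CharZero k ∨ ∀ u ∈ p.support, u none = 0) :
    ∃ N : ℕ, ∀ n : ℕ, N ≤ n →
      MvPolynomial.eval (fun o : Option (Fin v) => o.elim (n : K) fun j => (q j : K) ^ n) p ≠ 0 := by
  classical
  have hinj := algebraicIndependent_iff_injective_aeval.mp hq
  let f : MvPolynomial (Fin v) k →ₐ[k] K := MvPolynomial.aeval fun i => (q i : K)
  let _ : Algebra (MvPolynomial (Fin v) k) K := f.toRingHom.toAlgebra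
  have hf : ∀ x, algebraMap (MvPolynomial (Fin v) k) K x = f x := fun _ => rfl
  have : FaithfulSMul (MvPolynomial (Fin v) k) K :=
    (faithfulSMul_iff_algebraMap_injective _ _).mpr hinj
  have : IsFractionRing (MvPolynomial (Fin v) k) K := IsFractionRing.of_field _ _ fun z => by
    have hz : z ∈ IntermediateField.adjoin k (Set.range fun i => (q i : K)) := by rw [hK]; trivial
    exact (IntermediateField.mem_adjoin_range_iff k _ z).mp hz
  obtain ⟨D, hD⟩ := IsLocalization.exist_integer_multiples_of_finset
    (nonZeroDivisors (MvPolynomial (Fin v) k)) (S := K) (p.support.image fun u => p.coeff u)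
  have hD0 : f (D : MvPolynomial (Fin v) k) ≠ 0 := by
    intro h0
    exact nonZeroDivisors.coe_ne_zero D (hinj (by rw [map_zero]; exact h0))
  have hC : ∀ u, ∃ C : MvPolynomial (Fin v) k, u ∈ p.support → f C = f D * p.coeff u := by
    intro u
    by_cases hu : u ∈ p.support
    · obtain ⟨C, hC⟩ := hD _ (Finset.mem_image_of_mem _ hu)
      exact ⟨C, fun _ => by rw [← hf C, hC, ← hf, Algebra.smul_def]⟩
    · exact ⟨0, fun h => absurd h hu⟩
  choose C hC using hC
  obtain ⟨N, hN⟩ := exists_forall_sum_monomial_ne_zero p.support C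
    (MvPolynomial.support_nonempty.mpr hp)
    (fun u hu h0 => by
      have h1 := hC u hu
      rw [h0, map_zero] at h1
      exact mul_ne_zero hD0 (MvPolynomial.mem_support_iff.mp hu) h1.symm) h
  refine ⟨N, fun n hn h0 => hN n hn (hinj ?_)⟩
  rw [map_zero, map_sum]
  have : ∀ u ∈ p.support, MvPolynomial.aeval (fun i => (q i : K))
      (C u * MvPolynomial.monomial (n • u.some) ((n : k) ^ u none)) =
      f D * (p.coeff u * ∏ o, (o.elim (n : K) fun j => (q j : K) ^ n) ^ u o) := by
    intro u hu
    rw [map_mul]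
    change f (C u) * _ = _
    rw [hC u hu, MvPolynomial.aeval_monomial, Fintype.prod_option, mul_assoc,
      Finsupp.prod_fintype _ _ (fun i => pow_zero _)]
    simp [pow_mul]
  rw [Finset.sum_congr rfl this, ← Finset.mul_sum, ← MvPolynomial.eval_eq', h0, mul_zero]

/-- Renaming embeds the variables that are present into `Option (Fin v)`. In the multibasic case
`none` does not occur, so the characteristic plays no role there. -/
theorem exists_forall_polyEval_ne_zero (q : Fin v → Kˣ)
    (hq : AlgebraicIndependent k (fun i => (q i : K)))
    (hK : IntermediateField.adjoin k (Set.range fun i => (q i : K)) = ⊤)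
    (kd : GroundKind) (hchar : kd = .multibasic ∨ CharZero k)
    (p : GroundPoly kd K v) (hp : p ≠ 0) :
    ∃ N : ℕ, ∀ n : ℕ, N ≤ n → polyEval kd q p n ≠ 0 := by
  classical
  obtain ⟨N, hN⟩ := exists_forall_eval_option_ne_zero q hq hK
    (MvPolynomial.rename Subtype.val p)
    (fun h0 => hp (MvPolynomial.rename_injective _ Subtype.val_injective (by rw [h0, map_zero])))
    (by
      rcases hchar with h | h
      · right
        subst h
        intro u hu
        rw [MvPolynomial.support_rename_of_injective Subtype.val_injective] at hu
        obtain ⟨w, -, rfl⟩ := Finset.mem_image.mp hu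
        refine Finsupp.mapDomain_of_notMem_range _ _ ?_
        rintro ⟨⟨i, hi⟩, rfl⟩
        exact hi rfl
      · exact Or.inl h)
  refine ⟨N, fun n hn h0 => hN n hn ?_⟩
  rw [MvPolynomial.eval_rename, ← h0, polyEval]
  congr 2
  funext ⟨i, hi⟩
  cases i <;> rfl

end Nonvanishing

/-! ### Evaluation of the ground field in the ring of sequences -/

section GroundHom

variable (kd : GroundKind) {K : Type*} [Field K] {v : ℕ} (q : Fin v → Kˣ)

/-- Nonzero polynomials do not vanish at `(n, q_1 ^ n, …, q_v ^ n)` for large `n`. -/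
def EventuallyNonzero : Prop :=
  ∀ p : GroundPoly kd K v, p ≠ 0 → ∃ N : ℕ, ∀ n : ℕ, N ≤ n → polyEval kd q p n ≠ 0

/-- The sequence of values of a polynomial. -/
def polySeq : GroundPoly kd K v →+* SeqRing K :=
  (Filter.Germ.coeRingHom Filter.atTop).comp
    (RingHom.pi fun n => (MvPolynomial.eval (evalPoint kd q n) : GroundPoly kd K v →+* K))

theorem polySeq_apply (p : GroundPoly kd K v) :
    polySeq kd q p = ((polyEval kd q p : ℕ → K) : SeqRing K) := rfl

/-- The shift of sequences as a ring homomorphism. -/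
def seqShiftHom (K : Type*) [Field K] : SeqRing K →+* SeqRing K where
  toFun := seqShift
  map_one' := rfl
  map_zero' := rfl
  map_mul' a b := by
    induction a, b using Filter.Germ.inductionOn₂
    rfl
  map_add' a b := by
    induction a, b using Filter.Germ.inductionOn₂
    rfl

theorem seqShift_coe {K : Type*} (f : ℕ → K) :
    seqShift (f : SeqRing K) = ((fun n => f (n + 1) : ℕ → K) : SeqRing K) := rfl

theorem polyEval_polyShift (p : GroundPoly kd K v) (n : ℕ) :
    polyEval kd q (polyShift kd q p) n = polyEval kd q p (n + 1) := by
  have : (MvPolynomial.aeval (R := K) (evalPoint kd q n)).comp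
      (polyShift kd q : GroundPoly kd K v →ₐ[K] GroundPoly kd K v) =
      MvPolynomial.aeval (R := K) (evalPoint kd q (n + 1)) := by
    apply MvPolynomial.algHom_ext
    rintro ⟨i, hi⟩
    cases i with
    | none => simp [polyShift, shiftVar, evalPoint]
    | some j => simp [polyShift, shiftVar, evalPoint, pow_succ']
  have h := DFunLike.congr_fun this p
  simpa [polyEval, MvPolynomial.aeval_eq_eval] using h

theorem isUnit_coe_germ {f : ℕ → K} (h : ∃ N : ℕ, ∀ n, N ≤ n → f n ≠ 0) :
    IsUnit (f : SeqRing K) := by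
  refine IsUnit.of_mul_eq_one ((fun n => (f n)⁻¹ : ℕ → K) : SeqRing K) ?_
  obtain ⟨N, hN⟩ := h
  rw [← Filter.Germ.coe_mul, ← Filter.Germ.coe_one, Filter.Germ.coe_eq]
  exact Filter.eventually_atTop.mpr ⟨N, fun n hn => mul_inv_cancel₀ (hN n hn)⟩

variable {kd q}

/-- `groundEval` is not multiplicative at every `n`, because of poles and cancellation. As germs,
however, nonzero polynomials become units, so the universal property of the fraction field gives a
homomorphism, which agrees with `groundEval` past the zeros of the denominator. -/
theorem exists_groundHom (h : EventuallyNonzero kd q) :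
    ∃ φ : GroundField kd K v →+* SeqRing K,
      (∀ f, φ f = ((groundEval kd q f : ℕ → K) : SeqRing K)) ∧
      (∀ f, φ (groundShift kd q f) = seqShift (φ f)) ∧
      ∀ c : K, φ (algebraMap K (GroundField kd K v) c) = ((fun _ => c : ℕ → K) : SeqRing K) := by
  have hu : ∀ y : nonZeroDivisors (GroundPoly kd K v), IsUnit (polySeq kd q y) := fun y =>
    isUnit_coe_germ (h y (nonZeroDivisors.coe_ne_zero y))
  have hmap := IsLocalization.lift_eq (M := nonZeroDivisors (GroundPoly kd K v))
    (S := GroundField kd K v) hu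
  refine ⟨IsLocalization.lift (M := nonZeroDivisors (GroundPoly kd K v))
    (S := GroundField kd K v) hu, ?_, ?_, ?_⟩
  · intro f
    set d := IsFractionRing.den (GroundPoly kd K v) f
    have h1 : f * algebraMap _ _ (d : GroundPoly kd K v) =
        algebraMap _ _ (IsFractionRing.num (GroundPoly kd K v) f) :=
      IsFractionRing.num_mul_den_eq_num_iff_eq.mpr rfl
    apply (hu d).mul_right_cancel
    rw [← hmap, ← map_mul, h1, hmap, hmap, polySeq_apply, polySeq_apply, ← Filter.Germ.coe_mul,
      Filter.Germ.coe_eq]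
    obtain ⟨N, hN⟩ := h d (nonZeroDivisors.coe_ne_zero d)
    refine Filter.eventually_atTop.mpr ⟨N, fun n hn => ?_⟩
    rw [Pi.mul_apply, groundEval, if_neg (hN n hn), div_mul_cancel₀ _ (hN n hn)]
  · intro f
    have : (IsLocalization.lift (M := nonZeroDivisors (GroundPoly kd K v))
        (S := GroundField kd K v) hu).comp (groundShift kd q).toRingHom =
        (seqShiftHom K).comp (IsLocalization.lift hu) := by
      apply IsLocalization.ringHom_ext (nonZeroDivisors (GroundPoly kd K v))
      refine RingHom.ext fun p => ?_
      change IsLocalization.lift hu (groundShift kd q (algebraMap _ _ p)) =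
        seqShift (IsLocalization.lift hu (algebraMap _ _ p))
      rw [groundShift, IsFractionRing.ringEquivOfRingEquiv_algebraMap, hmap, hmap]
      change polySeq kd q (polyShift kd q p) = _
      rw [polySeq_apply, polySeq_apply, seqShift_coe]
      congr 1
      funext n
      rw [polyEval_polyShift]
    exact DFunLike.congr_fun this f
  · intro c
    rw [IsScalarTower.algebraMap_apply K (GroundPoly kd K v) (GroundField kd K v), hmap,
      polySeq_apply]
    congr 1
    funext n
    simp [polyEval, MvPolynomial.algebraMap_eq]

/-- The chosen denominator of a constant need not be 1, only a unit; its values are therefore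
nonzero everywhere, so the equality holds for every `n` and not just eventually. -/
theorem groundEval_algebraMap (c : K) (n : ℕ) :
    groundEval kd q (algebraMap K (GroundField kd K v) c) n = c := by
  have hint : IsLocalization.IsInteger (GroundPoly kd K v)
      (algebraMap K (GroundField kd K v) c) := ⟨MvPolynomial.C c, rfl⟩
  set f := algebraMap K (GroundField kd K v) c with hf
  have hu := (IsFractionRing.isUnit_den_iff _).mpr hint
  have h1 : f * algebraMap _ _ (IsFractionRing.den (GroundPoly kd K v) f : GroundPoly kd K v) =
      algebraMap _ _ (IsFractionRing.num (GroundPoly kd K v) f) :=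
    IsFractionRing.num_mul_den_eq_num_iff_eq.mpr rfl
  have h2 : MvPolynomial.C c * (IsFractionRing.den (GroundPoly kd K v) f : GroundPoly kd K v) =
      IsFractionRing.num (GroundPoly kd K v) f := by
    apply IsFractionRing.injective (GroundPoly kd K v) (GroundField kd K v)
    rw [map_mul, ← h1]
    rfl
  have h3 : polyEval kd q (IsFractionRing.den (GroundPoly kd K v) f : GroundPoly kd K v) n ≠ 0 :=
    (hu.map (MvPolynomial.eval (evalPoint kd q n))).ne_zero
  rw [groundEval, if_neg h3, div_eq_iff h3, ← h2, polyEval, polyEval, map_mul,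
    MvPolynomial.eval_C]

theorem groundEval_zero (n : ℕ) : groundEval kd q (0 : GroundField kd K v) n = 0 := by
  simpa using groundEval_algebraMap (kd := kd) (q := q) 0 n

theorem groundEval_one (n : ℕ) : groundEval kd q (1 : GroundField kd K v) n = 1 := by
  simpa using groundEval_algebraMap (kd := kd) (q := q) 1 n

/-- A root of unity is integral over the polynomial ring, which is integrally closed, and a unit of
the polynomial ring is a constant. This gives `RPow(α_i)` its argument in `K`. -/
theorem exists_algebraMap_eq_of_pow_eq_one {a : GroundField kd K v} {n : ℕ} (hn : 0 < n)
    (h : a ^ n = 1) : ∃ c : K, a = algebraMap K (GroundField kd K v) c := by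
  have hint : IsIntegral (GroundPoly kd K v) a :=
    IsIntegral.of_pow hn (by rw [h]; exact isIntegral_one)
  obtain ⟨p, rfl⟩ := IsIntegrallyClosed.isIntegral_iff.mp hint
  rw [← map_pow, ← map_one (algebraMap (GroundPoly kd K v) (GroundField kd K v))] at h
  have hp := IsFractionRing.injective (GroundPoly kd K v) (GroundField kd K v) h
  have hu : IsUnit p := IsUnit.of_pow_eq_one hp hn.ne'
  obtain ⟨c, -, rfl⟩ := MvPolynomial.isUnit_iff_eq_C_of_isReduced.mp hu
  exact ⟨c, rfl⟩

end GroundHom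

/-! ### Integer powers and exponents -/

section RingZPow

variable {R R' : Type*} [CommRing R] [CommRing R']

theorem ringZPow_natCast (x : R) (n : ℕ) : ringZPow x (n : ℤ) = x ^ n := rfl

theorem ringZPow_zero (x : R) : ringZPow x 0 = 1 := pow_zero x

theorem ringZPow_one (x : R) : ringZPow x 1 = x := pow_one x

theorem ringZPow_of_nonneg (x : R) {z : ℤ} (h : 0 ≤ z) : ringZPow x z = x ^ z.toNat := by
  lift z to ℕ using h
  rfl

theorem ringZPow_unit (u : Rˣ) (z : ℤ) : ringZPow (u : R) z = ((u ^ z : Rˣ) : R) := by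
  cases z with
  | ofNat n => simp [ringZPow]
  | negSucc n => simp [ringZPow, zpow_negSucc]

theorem ringZPow_eq_zpow {F : Type*} [Field F] (x : F) (z : ℤ) : ringZPow x z = x ^ z := by
  cases z with
  | ofNat n => simp [ringZPow]
  | negSucc n => simp [ringZPow, zpow_negSucc]

/-- `Ring.inverse` is 0 on nonunits, and a homomorphism may turn a nonunit into a unit; hence the
condition on negative exponents. -/
theorem map_ringZPow (φ : R →+* R') {x : R} {z : ℤ} (h : IsUnit x ∨ 0 ≤ z) :
    φ (ringZPow x z) = ringZPow (φ x) z := by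
  rcases h with ⟨u, rfl⟩ | h
  · have : φ (u : R) = ((Units.map (φ : R →* R') u : R'ˣ) : R') := rfl
    rw [this, ringZPow_unit, ringZPow_unit, ← map_zpow]
    rfl
  · rw [ringZPow_of_nonneg _ h, ringZPow_of_nonneg _ h, map_pow]

theorem ringZPow_add {x : R} (h : IsUnit x) (y z : ℤ) :
    ringZPow x (y + z) = ringZPow x y * ringZPow x z := by
  obtain ⟨u, rfl⟩ := h
  rw [ringZPow_unit, ringZPow_unit, ringZPow_unit, zpow_add, Units.val_mul]

/-- The power product `r_1 ^ m_1 ⋯ r_e ^ m_e`. -/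
def powerProduct {ι : Type*} [Fintype ι] (r : ι → R) (m : ι → ℤ) : R := ∏ i, ringZPow (r i) (m i)

theorem powerProduct_zero {ι : Type*} [Fintype ι] (r : ι → R) : powerProduct r 0 = 1 :=
  Finset.prod_eq_one fun _ _ => ringZPow_zero _

theorem powerProduct_update {ι : Type*} [Fintype ι] [DecidableEq ι] (r : ι → R) (m : ι → ℤ)
    (i : ι) (z : ℤ) : powerProduct r (Function.update m i z) =
      powerProduct r (Function.update m i 0) * ringZPow (r i) z := by
  have h : ∀ y : ℤ, powerProduct r (Function.update m i y) =
      ringZPow (r i) y * ∏ j ∈ Finset.univ \ {i}, ringZPow (r j) (m j) := by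
    intro y
    rw [← Finset.prod_update_of_mem (Finset.mem_univ i)]
    refine Finset.prod_congr rfl fun j _ => ?_
    by_cases hj : j = i
    · subst hj; simp
    · simp [hj]
  rw [h z, h 0, ringZPow_zero, one_mul, mul_comm]

theorem powerProduct_single {ι : Type*} [Fintype ι] [DecidableEq ι] (r : ι → R) (i : ι) (z : ℤ) :
    powerProduct r (Function.update 0 i z) = ringZPow (r i) z := by
  have h0 : Function.update (0 : ι → ℤ) i 0 = 0 := Function.update_eq_self i (0 : ι → ℤ)
  rw [powerProduct_update, h0, powerProduct_zero, one_mul]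

end RingZPow

namespace MonomialKind

variable {R : Type*} [CommRing R]

/-- The relations which a monomial of the given kind satisfies. -/
def Compatible (r : R) : MonomialKind → Prop
  | .A ν => 1 < ν ∧ r ^ ν = 1
  | .P => IsUnit r
  | .S => True

/-- The reduction of an exponent. -/
def red : MonomialKind → ℤ → ℤ
  | .A ν, z => z % ν
  | _, z => z

theorem Compatible.isUnit {κ : MonomialKind} {r : R} (h : κ.Compatible r) (hS : κ ≠ .S) :
    IsUnit r := by
  cases κ with
  | A ν => exact IsUnit.of_pow_eq_one h.2 (by have := h.1; omega)
  | P => exact h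
  | S => exact absurd rfl hS

theorem Compatible.isUnit_or_nonneg {κ : MonomialKind} {r : R} (h : κ.Compatible r) {z : ℤ}
    (hz : z ∈ κ.exponents) : IsUnit r ∨ 0 ≤ z := by
  cases κ with
  | A ν => exact Or.inr hz.1
  | P => exact Or.inl h
  | S => exact Or.inr hz

theorem Compatible.zero_mem {κ : MonomialKind} {r : R} (h : κ.Compatible r) :
    0 ∈ κ.exponents := by
  cases κ with
  | A ν => exact ⟨le_rfl, by have := h.1; omega⟩
  | P => trivial
  | S => exact le_rfl (α := ℤ)

theorem Compatible.one_mem {κ : MonomialKind} {r : R} (h : κ.Compatible r) :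
    1 ∈ κ.exponents := by
  cases κ with
  | A ν => exact ⟨zero_le_one, by have := h.1; omega⟩
  | P => trivial
  | S => exact zero_le_one (α := ℤ)

theorem Compatible.red_mem {κ : MonomialKind} {r : R} (h : κ.Compatible r) {y z : ℤ}
    (hy : y ∈ κ.exponents) (hz : z ∈ κ.exponents) : κ.red (y + z) ∈ κ.exponents := by
  cases κ with
  | A ν =>
    have : (0 : ℤ) < ν := by have := h.1; omega
    exact ⟨Int.emod_nonneg _ this.ne', Int.emod_lt_of_pos _ this⟩
  | P => trivial
  | S => exact add_nonneg (show (0 : ℤ) ≤ y from hy) hz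

theorem Compatible.ringZPow_red {κ : MonomialKind} {r : R} (h : κ.Compatible r) {y z : ℤ}
    (hy : y ∈ κ.exponents) (hz : z ∈ κ.exponents) :
    ringZPow r (κ.red (y + z)) = ringZPow r y * ringZPow r z := by
  cases κ with
  | A ν =>
    have hu := h.isUnit (by simp)
    rw [← ringZPow_add hu]
    obtain ⟨u, rfl⟩ := hu
    have h1 : u ^ (ν : ℤ) = 1 := by
      ext
      rw [zpow_natCast]
      simpa using h.2
    simp only [red]
    rw [ringZPow_unit, ringZPow_unit]
    conv_rhs => rw [← Int.emod_add_mul_ediv (y + z) ν, zpow_add, zpow_mul, h1, one_zpow, mul_one]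
  | P => exact ringZPow_add h y z
  | S =>
    have hy : 0 ≤ y := hy
    have hz : 0 ≤ z := hz
    simp only [red]
    rw [ringZPow_of_nonneg _ hy, ringZPow_of_nonneg _ hz, ringZPow_of_nonneg _ (add_nonneg hy hz),
      Int.toNat_add hy hz, pow_add]

/-- The degrees of the polynomials which represent ring elements uniquely. -/
def DegreeAllowed : MonomialKind → ℕ → Prop
  | .A ν, d => d < ν
  | _, _ => True

theorem DegreeAllowed.mono {κ : MonomialKind} {d d' : ℕ} (h : κ.DegreeAllowed d) (hd : d' ≤ d) :
    κ.DegreeAllowed d' := by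
  cases κ with
  | A ν => exact lt_of_le_of_lt hd h
  | P => trivial
  | S => trivial

end MonomialKind

/-! ### Single steps of the tower -/

namespace IsAPSStep

variable {E : Type*} [CommRing E] {A B : Subring E} {t α β : E} {κ : MonomialKind}

theorem compatible (h : IsAPSStep A B t α β κ) : κ.Compatible t := by
  cases κ with
  | A ν =>
    obtain ⟨hν, -, hker, -⟩ := h
    refine ⟨hν, ?_⟩
    have : (X ^ ν - 1 : A[X]) ∈ RingHom.ker (aeval (R := A) t : A[X] →ₐ[A] E) := by
      rw [hker]; exact Ideal.mem_span_singleton_self _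
    rw [RingHom.mem_ker] at this
    simpa [sub_eq_zero] using this
  | P => obtain ⟨⟨u, rfl, -⟩, -⟩ := h; exact u.isUnit
  | S => trivial

theorem base_le (h : IsAPSStep A B t α β κ) : A ≤ B := by
  cases κ with
  | A ν => rw [h.2.1]; exact fun x hx => Subring.subset_closure (Or.inl hx)
  | P => obtain ⟨⟨u, -, rfl⟩, -⟩ := h; exact fun x hx => Subring.subset_closure (Or.inl hx)
  | S => rw [h.1]; exact fun x hx => Subring.subset_closure (Or.inl hx)

theorem gen_mem (h : IsAPSStep A B t α β κ) : t ∈ B := by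
  cases κ with
  | A ν => rw [h.2.1]; exact Subring.subset_closure (Or.inr rfl)
  | P => obtain ⟨⟨u, -, rfl⟩, -⟩ := h; exact Subring.subset_closure (Or.inr (Or.inl rfl))
  | S => rw [h.1]; exact Subring.subset_closure (Or.inr rfl)

/-- The form in which a property is propagated from `A` to `B`: `S` is a preimage or an equalizer.
Only a `P`-monomial adds a second generator, its inverse, here characterized by `t * u = 1`. -/
theorem le_of_mem (h : IsAPSStep A B t α β κ) {S : Subring E} (hA : A ≤ S) (ht : t ∈ S)
    (hu : κ = .P → ∀ u, t * u = 1 → u ∈ S) : B ≤ S := by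
  cases κ with
  | A ν =>
    rw [h.2.1, Subring.closure_le]
    exact Set.union_subset hA (Set.singleton_subset_iff.mpr ht)
  | P =>
    obtain ⟨⟨u, rfl, rfl⟩, -⟩ := h
    rw [Subring.closure_le]
    refine Set.union_subset hA (Set.insert_subset ht (Set.singleton_subset_iff.mpr ?_))
    exact hu rfl _ u.mul_inv
  | S =>
    rw [h.1, Subring.closure_le]
    exact Set.union_subset hA (Set.singleton_subset_iff.mpr ht)

theorem inverse_mem (h : IsAPSStep A B t α β κ) (hS : κ ≠ .S) : ∃ u ∈ B, t * u = 1 := by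
  cases κ with
  | A ν =>
    have hc := h.compatible
    refine ⟨t ^ (ν - 1), pow_mem h.gen_mem _, ?_⟩
    rw [← pow_succ', Nat.sub_add_cancel (by have := hc.1; omega)]
    exact hc.2
  | P =>
    obtain ⟨⟨u, rfl, rfl⟩, -⟩ := h
    exact ⟨_, Subring.subset_closure (Or.inr (Or.inr rfl)), u.mul_inv⟩
  | S => exact absurd rfl hS

theorem shiftQuotient_mem (h : IsAPSStep A B t α β κ) : α ∈ A := by
  cases κ with
  | A ν => exact h.2.2.2.1
  | P => obtain ⟨-, -, ⟨a, rfl⟩, -⟩ := h; exact (a : A).2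
  | S => rw [h.2.2.1]; exact one_mem _

theorem exists_shiftQuotient_mul_eq_one (h : IsAPSStep A B t α β κ) : ∃ α' ∈ A, α * α' = 1 := by
  cases κ with
  | A ν =>
    obtain ⟨hν, -, -, hα, hpr, -⟩ := h
    refine ⟨α ^ (ν - 1), pow_mem hα _, ?_⟩
    rw [← pow_succ', Nat.sub_add_cancel (by omega)]
    exact hpr.pow_eq_one
  | P =>
    obtain ⟨-, -, ⟨a, rfl⟩, -⟩ := h
    exact ⟨((a⁻¹ : Aˣ) : A), Subtype.property _, congrArg Subtype.val a.mul_inv⟩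
  | S => exact ⟨1, one_mem _, by rw [h.2.2.1, one_mul]⟩

theorem shiftDifference_mem (h : IsAPSStep A B t α β κ) : β ∈ A := by
  cases κ with
  | A ν => rw [h.2.2.2.2.2]; exact zero_mem _
  | P => rw [h.2.2.2]; exact zero_mem _
  | S => exact h.2.2.2

theorem shiftDifference_eq_zero (h : IsAPSStep A B t α β κ) (hS : κ ≠ .S) : β = 0 := by
  cases κ with
  | A ν => exact h.2.2.2.2.2
  | P => exact h.2.2.2
  | S => exact absurd rfl hS

theorem aeval_mem (h : IsAPSStep A B t α β κ) (F : A[X]) : aeval t F ∈ B := by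
  rw [aeval_eq_sum_range]
  refine sum_mem fun i _ => ?_
  rw [Algebra.smul_def]
  exact mul_mem (h.base_le (F.coeff i).2) (pow_mem h.gen_mem i)

/-- A power of `t` clears the negative exponents of a Laurent polynomial; in the other two cases `B`
already consists of polynomial values. -/
theorem exists_aeval_eq (h : IsAPSStep A B t α β κ) {b : E} (hb : b ∈ B) :
    ∃ (N : ℕ) (F : A[X]), (κ = .P ∨ N = 0) ∧ b * t ^ N = aeval t F := by
  have key : κ ≠ .P → ∃ F : A[X], aeval t F = b := by
    intro hP
    have : B ≤ (aeval (R := A) t : A[X] →ₐ[A] E).toRingHom.range :=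
      h.le_of_mem (fun a ha => ⟨C ⟨a, ha⟩, aeval_C t (⟨a, ha⟩ : A)⟩) ⟨X, by simp⟩
        (fun h => absurd h hP)
    exact this hb
  by_cases hP : κ = .P
  · subst hP
    obtain ⟨⟨u, rfl, rfl⟩, -⟩ := h
    suffices ∃ (N : ℕ) (F : A[X]), b * (u : E) ^ N = aeval (u : E) F by
      obtain ⟨N, F, hF⟩ := this
      exact ⟨N, F, Or.inl rfl, hF⟩
    clear key
    induction hb using Subring.closure_induction with
    | mem x hx =>
      rcases hx with hx | rfl | rfl
      · exact ⟨0, C ⟨x, hx⟩, by rw [pow_zero, mul_one]; exact (aeval_C _ (⟨x, hx⟩ : A)).symm⟩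
      · exact ⟨0, X, by simp⟩
      · exact ⟨1, 1, by simp⟩
    | zero => exact ⟨0, 0, by simp⟩
    | one => exact ⟨0, 1, by simp⟩
    | add x y _ _ hx hy =>
      obtain ⟨N, F, hF⟩ := hx
      obtain ⟨M, G, hG⟩ := hy
      refine ⟨N + M, F * X ^ M + G * X ^ N, ?_⟩
      simp only [map_add, map_mul, map_pow, aeval_X, ← hF, ← hG]
      ring
    | neg x _ hx =>
      obtain ⟨N, F, hF⟩ := hx
      exact ⟨N, -F, by rw [map_neg, ← hF, neg_mul]⟩
    | mul x y _ _ hx hy =>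
      obtain ⟨N, F, hF⟩ := hx
      obtain ⟨M, G, hG⟩ := hy
      refine ⟨N + M, F * G, ?_⟩
      rw [map_mul, ← hF, ← hG]
      ring
  · obtain ⟨F, hF⟩ := key hP
    exact ⟨0, F, Or.inr rfl, by rw [pow_zero, mul_one, hF]⟩

/-- For an `A`-monomial, `F` is a multiple of the monic polynomial `X ^ ν - 1`, so its degree is at
least `ν` unless it is zero. -/
theorem eq_zero_of_aeval_eq_zero (h : IsAPSStep A B t α β κ) {F : A[X]}
    (hd : κ.DegreeAllowed F.natDegree) (hF : aeval t F = 0) : F = 0 := by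
  cases κ with
  | A ν =>
    have hF' : F ∈ RingHom.ker (aeval (R := A) t : A[X] →ₐ[A] E) := hF
    rw [h.2.2.1, Ideal.mem_span_singleton] at hF'
    by_contra h0
    have hm : (X ^ ν - 1 : A[X]).Monic := by
      rw [← C_1]; exact monic_X_pow_sub_C 1 (by have := h.1; omega)
    rcases subsingleton_or_nontrivial A with hs | hs
    · exact h0 (Subsingleton.elim _ _)
    obtain ⟨G, hG⟩ := hF'
    have hG0 : G ≠ 0 := by rintro rfl; exact h0 (by rw [hG, mul_zero])
    have h2 := hm.natDegree_mul' hG0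
    rw [← hG, ← C_1, natDegree_X_pow_sub_C] at h2
    have hd : F.natDegree < ν := hd
    omega
  | P => exact (injective_iff_map_eq_zero _).mp h.2.1 F hF
  | S => exact (injective_iff_map_eq_zero _).mp h.2.1 F hF

theorem exists_reduced (h : IsAPSStep A B t α β κ) (F : A[X]) :
    ∃ G : A[X], κ.DegreeAllowed G.natDegree ∧ aeval t G = aeval t F := by
  cases κ with
  | A ν =>
    have hν : ν ≠ 0 := by have := h.1; omega
    have hm : (X ^ ν - 1 : A[X]).Monic := by
      rw [← C_1]; exact monic_X_pow_sub_C 1 hν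
    refine ⟨F %ₘ (X ^ ν - 1), ?_, ?_⟩
    · rcases subsingleton_or_nontrivial A with hs | hs
      · rw [Subsingleton.elim (F %ₘ (X ^ ν - 1)) 0]
        exact Nat.pos_of_ne_zero hν
      · have h1 := natDegree_modByMonic_lt F hm (by
          intro h1
          have := congrArg natDegree h1
          rw [← C_1, natDegree_X_pow_sub_C, natDegree_C] at this
          exact hν this)
        rwa [← C_1, natDegree_X_pow_sub_C, C_1] at h1
    · conv_rhs => rw [← modByMonic_add_div F (X ^ ν - 1)]
      simp [h.compatible.2]
  | P => exact ⟨F, trivial, rfl⟩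
  | S => exact ⟨F, trivial, rfl⟩

theorem exists_sum_eq (h : IsAPSStep A B t α β κ) {b : E} (hb : b ∈ B) :
    ∃ (Z : Finset ℤ) (a : ℤ → E), (∀ z ∈ Z, z ∈ κ.exponents) ∧ (∀ z, a z ∈ A) ∧
      b = ∑ z ∈ Z, a z * ringZPow t z := by
  classical
  obtain ⟨N, F, hN, hF⟩ := h.exists_aeval_eq hb
  obtain ⟨G, hG, hGF⟩ := h.exists_reduced F
  -- The term of degree `n` in `b * t ^ N` belongs to the exponent `n - N` in `b`.
  refine ⟨(Finset.range (G.natDegree + 1)).image fun n : ℕ => (n : ℤ) - N,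
    fun z => G.coeff (z + N).toNat, ?_, fun z => Subtype.property _, ?_⟩
  · intro z hz
    obtain ⟨n, hn, rfl⟩ := Finset.mem_image.mp hz
    have hn : n < G.natDegree + 1 := Finset.mem_range.mp hn
    cases κ with
    | A ν =>
      have hN : N = 0 := by simpa using hN
      have hG : G.natDegree < ν := hG
      subst hN
      constructor <;> omega
    | P => trivial
    | S =>
      have hN : N = 0 := by simpa using hN
      subst hN
      change (0 : ℤ) ≤ _
      omega
  · rw [Finset.sum_image (by intro x _ y _ hxy; simpa using hxy)]
    have hb : b * t ^ N = ∑ n ∈ Finset.range (G.natDegree + 1), (G.coeff n : E) * t ^ n := by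
      rw [hF, ← hGF, aeval_eq_sum_range]
      rfl
    rcases hN with rfl | rfl
    · have hu : IsUnit t := h.compatible
      apply (hu.pow N).mul_right_cancel
      rw [hb, Finset.sum_mul]
      refine Finset.sum_congr rfl fun n _ => ?_
      simp only [sub_add_cancel, Int.toNat_natCast]
      rw [mul_assoc, ← ringZPow_natCast t N, ← ringZPow_add hu,
        sub_add_cancel, ringZPow_natCast]
    · rw [pow_zero, mul_one] at hb
      rw [hb]
      refine Finset.sum_congr rfl fun n _ => ?_
      simp [ringZPow_natCast]

theorem eq_zero_of_sum_eq_zero (h : IsAPSStep A B t α β κ) {Z : Finset ℤ} {a : ℤ → E}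
    (hZ : ∀ z ∈ Z, z ∈ κ.exponents) (ha : ∀ z, a z ∈ A)
    (h0 : ∑ z ∈ Z, a z * ringZPow t z = 0) : ∀ z ∈ Z, a z = 0 := by
  classical
  set N : ℕ := Z.sup fun z => (-z).toNat with hN
  have hNz : ∀ z ∈ Z, 0 ≤ z + N := by
    intro z hz
    have : (-z).toNat ≤ N := Finset.le_sup (f := fun z : ℤ => (-z).toNat) hz
    omega
  -- For an `A`-monomial the shift of exponents by `N` has to be trivial, since the degree must stay
  -- below `ν`.
  have hN0 : κ ≠ .P → N = 0 := by
    intro hP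
    rw [hN]
    refine Nat.eq_zero_of_le_zero (Finset.sup_le fun z hz => ?_)
    have := hZ z hz
    cases κ with
    | A ν => have := this.1; omega
    | P => exact absurd rfl hP
    | S => have : 0 ≤ z := this; omega
  set F : A[X] := ∑ z ∈ Z, monomial (z + N).toNat (⟨a z, ha z⟩ : A) with hFdef
  have hF : aeval t F = 0 := by
    have : aeval t F = (∑ z ∈ Z, a z * ringZPow t z) * t ^ N := by
      rw [hFdef, map_sum, Finset.sum_mul]
      refine Finset.sum_congr rfl fun z hz => ?_
      rw [aeval_monomial, mul_assoc, ← ringZPow_of_nonneg t (hNz z hz)]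
      change a z * _ = _
      congr 1
      by_cases hP : κ = .P
      · subst hP
        rw [ringZPow_add h.compatible, ringZPow_natCast]
      · rw [hN0 hP]; simp
    rw [this, h0, zero_mul]
  have hF0 : F = 0 := by
    refine h.eq_zero_of_aeval_eq_zero ?_ hF
    cases κ with
    | A ν =>
      have hν := h.1
      refine lt_of_le_of_lt (natDegree_sum_le_of_forall_le (n := ν - 1) _ _ fun z hz => ?_)
        (show ν - 1 < ν by omega)
      refine (natDegree_monomial_le _).trans ?_
      have := (hZ z hz).2
      rw [hN0 (by simp)]
      omega
    | P => trivial
    | S => trivial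
  intro z hz
  have h1 : F.coeff (z + N).toNat = ⟨a z, ha z⟩ := by
    rw [hFdef, finsetSum_coeff, Finset.sum_eq_single z]
    · simp
    · intro y hy hyz
      rw [coeff_monomial, if_neg]
      have := hNz y hy
      have := hNz z hz
      omega
    · intro hn; exact absurd hz hn
  rw [hF0, coeff_zero] at h1
  exact (congrArg Subtype.val h1).symm

end IsAPSStep

namespace APSExtension

/-! ### Reduced representations -/

section Tower

variable {G : Type*} [Field G] {σ₀ : G ≃+* G} {E : Type*} [CommRing E] [Algebra G E] {e : ℕ}
  (X : APSExtension σ₀ E e)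

theorem compatible (i : Fin e) : (X.kind i).Compatible (X.t i) := (X.step i).compatible

theorem tower_mono : Monotone X.tower :=
  Fin.monotone_iff_le_succ.mpr fun i => (X.step i).base_le

theorem algebraMap_mem_tower (i : Fin (e + 1)) (a : G) : algebraMap G E a ∈ X.tower i :=
  X.tower_mono (Fin.zero_le i) (by rw [X.tower_zero]; exact ⟨a, rfl⟩)

theorem shift_mem_tower (i : Fin (e + 1)) : ∀ f ∈ X.tower i, X.shift f ∈ X.tower i := by
  induction i using Fin.induction with
  | zero =>
    intro f hf
    rw [X.tower_zero] at hf ⊢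
    obtain ⟨a, rfl⟩ := hf
    exact ⟨σ₀ a, (X.shift_algebraMap a).symm⟩
  | succ i ih =>
    have hs := X.step i
    have ht : X.shift (X.t i) ∈ X.tower i.succ := by
      rw [X.shift_t]
      exact add_mem (mul_mem (hs.base_le hs.shiftQuotient_mem) hs.gen_mem)
        (hs.base_le hs.shiftDifference_mem)
    refine hs.le_of_mem (S := (X.tower i.succ).comap X.shift.toRingHom)
      (fun a ha => hs.base_le (ih a ha)) ht ?_
    intro hP u hu
    obtain ⟨u', hu', hu1⟩ := hs.inverse_mem (by rw [hP]; simp)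
    obtain ⟨a, ha, ha1⟩ := hs.exists_shiftQuotient_mul_eq_one
    have h0 := hs.shiftDifference_eq_zero (by rw [hP]; simp)
    have h1 : X.shift (X.t i) * X.shift u = 1 := by rw [← map_mul, hu, map_one]
    rw [X.shift_t, h0, add_zero] at h1
    have h2 : X.shift u = a * u' := by
      linear_combination (a * u') * h1 - X.shift u * a * X.α i * hu1 - X.shift u * ha1
    change X.shift u ∈ X.tower i.succ
    rw [h2]
    exact mul_mem (hs.base_le ha) hu'

/-- That σ maps a ring of the tower into itself does not make it onto. Here σ⁻¹(t) = σ⁻¹(α)⁻¹ (t -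
σ⁻¹(β)). This is what makes the recursions over σ⁻¹(α_i) and σ⁻¹(β_i) involve earlier monomials
only. -/
theorem shift_symm_mem_tower (i : Fin (e + 1)) :
    ∀ f ∈ X.tower i, X.shift.symm f ∈ X.tower i := by
  induction i using Fin.induction with
  | zero =>
    intro f hf
    rw [X.tower_zero] at hf ⊢
    obtain ⟨a, rfl⟩ := hf
    refine ⟨σ₀.symm a, ?_⟩
    rw [RingEquiv.eq_symm_apply, X.shift_algebraMap, RingEquiv.apply_symm_apply]
  | succ i ih =>
    have hs := X.step i
    obtain ⟨a, ha, ha1⟩ := hs.exists_shiftQuotient_mul_eq_one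
    have ha2 : X.shift.symm (X.α i) * X.shift.symm a = 1 := by rw [← map_mul, ha1, map_one]
    have h1 : X.t i = X.shift.symm (X.α i) * X.shift.symm (X.t i) + X.shift.symm (X.β i) := by
      rw [← map_mul, ← map_add, ← X.shift_t, RingEquiv.symm_apply_apply]
    have ht : X.shift.symm (X.t i) ∈ X.tower i.succ := by
      have h2 : X.shift.symm (X.t i) = X.shift.symm a * (X.t i - X.shift.symm (X.β i)) := by
        linear_combination -X.shift.symm (X.t i) * ha2 - X.shift.symm a * h1
      rw [h2]
      exact mul_mem (hs.base_le (ih _ ha))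
        (sub_mem hs.gen_mem (hs.base_le (ih _ hs.shiftDifference_mem)))
    refine hs.le_of_mem (S := (X.tower i.succ).comap X.shift.symm.toRingHom)
      (fun a ha => hs.base_le (ih a ha)) ht ?_
    intro hP u hu
    obtain ⟨u', hu', hu1⟩ := hs.inverse_mem (by rw [hP]; simp)
    have huu : u = u' := by linear_combination u' * hu - u * hu1
    have h0 := hs.shiftDifference_eq_zero (by rw [hP]; simp)
    rw [h0, map_zero, add_zero] at h1
    have h2 : X.shift.symm (X.t i) * X.shift.symm u = 1 := by rw [← map_mul, hu, map_one]
    have h3 : X.shift.symm u = X.shift.symm (X.α i) * u := by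
      linear_combination X.shift.symm (X.α i) * u * h2 - X.shift.symm u * hu +
        X.shift.symm u * u * h1
    change X.shift.symm u ∈ X.tower i.succ
    rw [h3, huu]
    exact mul_mem (hs.base_le (ih _ hs.shiftQuotient_mem)) hu'

/-- The exponent vectors of the reduced representations of elements of `X.tower i`. -/
def exponentsBelow (i : Fin (e + 1)) : Set (Fin e → ℤ) :=
  {m | (∀ j, m j ∈ (X.kind j).exponents) ∧ ∀ j : Fin e, i ≤ j.castSucc → m j = 0}

theorem update_zero_mem {i : Fin e} {m : Fin e → ℤ} (hm : m ∈ X.exponentsBelow i.succ) :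
    Function.update m i 0 ∈ X.exponentsBelow i.castSucc := by
  constructor
  · intro j
    by_cases hj : j = i
    · subst hj; simpa using (X.compatible j).zero_mem
    · simpa [hj] using hm.1 j
  · intro j hij
    by_cases hj : j = i
    · subst hj; simp
    · rw [Function.update_of_ne hj]
      refine hm.2 j ?_
      rw [Fin.succ_le_castSucc_iff]
      exact lt_of_le_of_ne (Fin.castSucc_le_castSucc_iff.mp hij) (Ne.symm hj)

theorem update_mem {i : Fin e} {m : Fin e → ℤ} (hm : m ∈ X.exponentsBelow i.castSucc) {z : ℤ}
    (hz : z ∈ (X.kind i).exponents) : Function.update m i z ∈ X.exponentsBelow i.succ := by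
  constructor
  · intro j
    by_cases hj : j = i
    · subst hj; simpa using hz
    · simpa [hj] using hm.1 j
  · intro j hij
    have hij := Fin.succ_le_castSucc_iff.mp hij
    rw [Function.update_of_ne hij.ne']
    exact hm.2 j (Fin.castSucc_le_castSucc_iff.mpr hij.le)

theorem powerProduct_mem_tower (i : Fin (e + 1)) :
    ∀ m ∈ X.exponentsBelow i, powerProduct X.t m ∈ X.tower i := by
  induction i using Fin.induction with
  | zero =>
    intro m hm
    have : m = 0 := funext fun j => hm.2 j (Fin.zero_le _)
    rw [this, powerProduct_zero]
    exact one_mem _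
  | succ i ih =>
    intro m hm
    have hs := X.step i
    rw [← Function.update_eq_self i m, powerProduct_update]
    refine mul_mem (hs.base_le (ih _ (X.update_zero_mem hm))) ?_
    rcases le_or_gt 0 (m i) with h | h
    · rw [ringZPow_of_nonneg _ h]
      exact pow_mem hs.gen_mem _
    · have hS : X.kind i ≠ .S := fun hS => by
        have := hm.1 i
        rw [hS] at this
        exact absurd this (not_le.mpr h)
      obtain ⟨u, hu, hu1⟩ := hs.inverse_mem hS
      have hU := ringZPow_add ((X.compatible i).isUnit hS) (m i) (-m i)
      rw [add_neg_cancel, ringZPow_zero, ringZPow_of_nonneg _ (neg_nonneg.mpr h.le)] at hU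
      have h2 : X.t i ^ (-m i).toNat * u ^ (-m i).toNat = 1 := by rw [← mul_pow, hu1, one_pow]
      have h3 : ringZPow (X.t i) (m i) = u ^ (-m i).toNat := by
        linear_combination -ringZPow (X.t i) (m i) * h2 - u ^ (-m i).toNat * hU
      rw [h3]
      exact pow_mem hu _

theorem tower_le_span (i : Fin (e + 1)) :
    ∀ f ∈ X.tower i, f ∈ Submodule.span G (powerProduct X.t '' X.exponentsBelow i) := by
  induction i using Fin.induction with
  | zero =>
    intro f hf
    rw [X.tower_zero] at hf
    obtain ⟨a, rfl⟩ := hf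
    rw [Algebra.algebraMap_eq_smul_one]
    refine Submodule.smul_mem _ _ (Submodule.subset_span ⟨0, ⟨fun j => ?_, fun j _ => rfl⟩, ?_⟩)
    · exact (X.compatible j).zero_mem
    · exact powerProduct_zero _
  | succ i ih =>
    intro f hf
    obtain ⟨Z, a, hZ, ha, rfl⟩ := (X.step i).exists_sum_eq hf
    refine sum_mem fun z hz => ?_
    have hspan := ih (a z) (ha z)
    generalize a z = b at hspan
    induction hspan using Submodule.span_induction with
    | mem x hx =>
      obtain ⟨m, hm, rfl⟩ := hx
      refine Submodule.subset_span ⟨Function.update m i z, X.update_mem hm (hZ z hz), ?_⟩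
      rw [powerProduct_update, ← hm.2 i le_rfl, Function.update_eq_self]
    | zero => rw [zero_mul]; exact zero_mem _
    | add x y _ _ hx hy => rw [add_mul]; exact add_mem hx hy
    | smul c x _ hx => rw [smul_mul_assoc]; exact Submodule.smul_mem _ _ hx

/-- Terms are grouped by their exponent of the last monomial. Each group sums to zero by uniqueness
for a single step, and inside a group that exponent is fixed, so it can be erased without merging
terms and the induction hypothesis applies. -/
theorem coeff_eq_zero_of_sum_eq_zero (i : Fin (e + 1)) :
    ∀ (s : Finset (Fin e → ℤ)) (c : (Fin e → ℤ) → G), (∀ m ∈ s, m ∈ X.exponentsBelow i) →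
      ∑ m ∈ s, algebraMap G E (c m) * powerProduct X.t m = 0 → ∀ m ∈ s, c m = 0 := by
  classical
  induction i using Fin.induction with
  | zero =>
    intro s c hs h0 m hm
    have hall : ∀ m ∈ s, m = 0 := fun m hm => funext fun j => (hs m hm).2 j (Fin.zero_le _)
    have hm0 := hall m hm
    subst hm0
    rw [Finset.sum_eq_single_of_mem 0 hm (fun b hb hb0 => absurd (hall b hb) hb0),
      powerProduct_zero, mul_one] at h0
    exact X.algebraMap_injective (by rw [h0, map_zero])
  | succ i ih =>
    intro s c hs h0
    set d : ℤ → E := fun z => ∑ m ∈ s.filter (fun m => m i = z),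
      algebraMap G E (c m) * powerProduct X.t (Function.update m i 0) with hd
    have hdA : ∀ z, d z ∈ X.tower i.castSucc := fun z => sum_mem fun m hm =>
      mul_mem (X.algebraMap_mem_tower _ _) (X.powerProduct_mem_tower _ _
        (X.update_zero_mem (hs m (Finset.mem_filter.mp hm).1)))
    have hsum : ∑ z ∈ s.image (fun m => m i), d z * ringZPow (X.t i) z = 0 := by
      rw [← h0, ← Finset.sum_fiberwise_of_maps_to (g := fun m => m i)
        (fun m hm => Finset.mem_image_of_mem (fun m : Fin e → ℤ => m i) hm)]
      refine Finset.sum_congr rfl fun z _ => ?_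
      rw [hd, Finset.sum_mul]
      refine Finset.sum_congr rfl fun m hm => ?_
      obtain ⟨-, rfl⟩ := Finset.mem_filter.mp hm
      conv_rhs => rw [← Function.update_eq_self i m, powerProduct_update]
      rw [mul_assoc]
      simp
    have hz := (X.step i).eq_zero_of_sum_eq_zero (fun z hz => by
      obtain ⟨m, hm, rfl⟩ := Finset.mem_image.mp hz
      exact (hs m hm).1 i) hdA hsum
    intro m hm
    have hdm := hz _ (Finset.mem_image_of_mem (fun m : Fin e → ℤ => m i) hm)
    have hinj : Set.InjOn (fun m' : Fin e → ℤ => Function.update m' i 0)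
        (s.filter fun m' => m' i = m i) := by
      intro a ha b hb hab
      have ha := (Finset.mem_filter.mp ha).2
      have hb := (Finset.mem_filter.mp hb).2
      ext j
      by_cases hj : j = i
      · subst hj; rw [ha, hb]
      · simpa [hj] using congrFun hab j
    have key := ih ((s.filter fun m' => m' i = m i).image fun m' => Function.update m' i 0)
      (fun m' => c (Function.update m' i (m i))) (fun m' hm' => by
        obtain ⟨a, ha, rfl⟩ := Finset.mem_image.mp hm'
        exact X.update_zero_mem (hs a (Finset.mem_filter.mp ha).1)) (by
        rw [Finset.sum_image hinj, ← hdm]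
        refine Finset.sum_congr rfl fun m' hm' => ?_
        rw [Function.update_idem, ← (Finset.mem_filter.mp hm').2, Function.update_eq_self])
      _ (Finset.mem_image_of_mem _ (Finset.mem_filter.mpr ⟨hm, rfl⟩))
    simpa using key

theorem isReducedRep_iff {f : E} {c : (Fin e → ℤ) →₀ G} : X.IsReducedRep f c ↔
    (∀ m ∈ c.support, m ∈ X.exponentsBelow (Fin.last e)) ∧
      f = ∑ m ∈ c.support, algebraMap G E (c m) * powerProduct X.t m := by
  have : ∀ m : Fin e → ℤ, m ∈ X.exponentsBelow (Fin.last e) ↔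
      ∀ i, m i ∈ (X.kind i).exponents := fun m =>
    ⟨fun h => h.1, fun h => ⟨h, fun j hj => absurd hj (not_le.mpr (Fin.castSucc_lt_last j))⟩⟩
  simp only [this]
  rfl

theorem exists_isReducedRep_of_mem {i : Fin (e + 1)} {f : E} (hf : f ∈ X.tower i) :
    ∃ c, X.IsReducedRep f c ∧ ∀ m ∈ c.support, m ∈ X.exponentsBelow i := by
  obtain ⟨c, hc, hcf⟩ :=
    (Finsupp.mem_span_image_iff_linearCombination G).mp (X.tower_le_span i f hf)
  have hc : ∀ m ∈ c.support, m ∈ X.exponentsBelow i := fun m hm => hc hm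
  refine ⟨c, X.isReducedRep_iff.mpr ⟨fun m hm => ⟨(hc m hm).1, fun j hj =>
    absurd hj (not_le.mpr (Fin.castSucc_lt_last j))⟩, ?_⟩, hc⟩
  rw [← hcf, Finsupp.linearCombination_apply]
  exact Finset.sum_congr rfl fun m _ => Algebra.smul_def _ _

variable {X} in
theorem IsReducedRep.unique {f : E} {c c' : (Fin e → ℤ) →₀ G} (h : X.IsReducedRep f c)
    (h' : X.IsReducedRep f c') : c = c' := by
  classical
  rw [isReducedRep_iff] at h h'
  have key := X.coeff_eq_zero_of_sum_eq_zero (Fin.last e) (c.support ∪ c'.support)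
    (fun m => c m - c' m) (fun m hm => by
      rcases Finset.mem_union.mp hm with hm | hm
      · exact h.1 m hm
      · exact h'.1 m hm) (by
      simp only [map_sub, sub_mul, Finset.sum_sub_distrib]
      rw [sub_eq_zero, ← Finset.sum_subset (s₁ := c.support) Finset.subset_union_left,
        ← Finset.sum_subset (s₁ := c'.support) Finset.subset_union_right, ← h.2, ← h'.2]
      · intro m _ hm
        rw [Finsupp.notMem_support_iff.mp hm, map_zero, zero_mul]
      · intro m _ hm
        rw [Finsupp.notMem_support_iff.mp hm, map_zero, zero_mul])
  ext m
  by_cases hm : m ∈ c.support ∪ c'.support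
  · exact sub_eq_zero.mp (key m hm)
  · rw [Finset.mem_union, not_or, Finsupp.notMem_support_iff, Finsupp.notMem_support_iff] at hm
    rw [hm.1, hm.2]

/-- Existence ensures that the `epsilon` in `reducedRep` makes a genuine choice. -/
theorem isReducedRep_reducedRep (f : E) : X.IsReducedRep f (X.reducedRep f) := by
  have hf : f ∈ X.tower (Fin.last e) := by rw [X.tower_last]; trivial
  obtain ⟨c, hc, -⟩ := X.exists_isReducedRep_of_mem hf
  exact Classical.epsilon_spec (p := X.IsReducedRep f) ⟨c, hc⟩

variable {X} in
theorem IsReducedRep.reducedRep_eq {f : E} {c : (Fin e → ℤ) →₀ G} (h : X.IsReducedRep f c) :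
    X.reducedRep f = c := (X.isReducedRep_reducedRep f).unique h

theorem support_reducedRep_subset {i : Fin (e + 1)} {f : E} (hf : f ∈ X.tower i) :
    ∀ m ∈ (X.reducedRep f).support, m ∈ X.exponentsBelow i := by
  obtain ⟨c, hc, hc'⟩ := X.exists_isReducedRep_of_mem hf
  rw [hc.reducedRep_eq]
  exact hc'

theorem exponents_of_mem_support {f : E} {m : Fin e → ℤ} (hm : m ∈ (X.reducedRep f).support) :
    ∀ i, m i ∈ (X.kind i).exponents := (X.isReducedRep_reducedRep f).1 m hm

theorem eq_sum_reducedRep (f : E) : f = ∑ m ∈ (X.reducedRep f).support,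
    algebraMap G E (X.reducedRep f m) * powerProduct X.t m :=
  (X.isReducedRep_iff.mp (X.isReducedRep_reducedRep f)).2

theorem reducedRep_term {a : G} {m : Fin e → ℤ} (hm : ∀ i, m i ∈ (X.kind i).exponents) :
    X.reducedRep (algebraMap G E a * powerProduct X.t m) = Finsupp.single m a := by
  refine IsReducedRep.reducedRep_eq ⟨fun m' hm' i => ?_, ?_⟩
  · rw [Finset.mem_singleton.mp (Finsupp.support_single_subset hm')]
    exact hm i
  · rw [Finsupp.sum_single_index (by simp)]
    rfl

theorem exponents_single {i : Fin e} {z : ℤ} (hz : z ∈ (X.kind i).exponents) :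
    ∀ j, Function.update (0 : Fin e → ℤ) i z j ∈ (X.kind j).exponents := by
  intro j
  by_cases hj : j = i
  · subst hj; simpa using hz
  · simpa [hj] using (X.compatible j).zero_mem

theorem reducedRep_t (i : Fin e) :
    X.reducedRep (X.t i) = Finsupp.single (Function.update (0 : Fin e → ℤ) i 1) 1 := by
  rw [← X.reducedRep_term (X.exponents_single (X.compatible i).one_mem), powerProduct_single,
    map_one, one_mul, ringZPow_one]

theorem reducedRep_eq_zero_iff {f : E} : X.reducedRep f = 0 ↔ f = 0 := by
  constructor
  · intro h
    rw [X.eq_sum_reducedRep f, h]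
    simp
  · rintro rfl
    exact IsReducedRep.reducedRep_eq ⟨by simp, by simp⟩

end Tower

/-! ### Simplicity of difference rings without new constants -/

section Simple

variable {E : Type*} [CommRing E]

/-- The subring `A` of the difference ring `(E, σ)` has no nontrivial `σ`-invariant ideals. -/
def IsShiftSimple (σ : E ≃+* E) (A : Subring E) : Prop :=
  ∀ I : AddSubgroup E, (∀ x ∈ I, x ∈ A) → (∀ a ∈ A, ∀ x ∈ I, a * x ∈ I) →
    (∀ x ∈ I, σ x ∈ I) → (∃ x ∈ I, x ≠ 0) → 1 ∈ I

/-- σ acts on polynomials in `t` by acting on the coefficients and substituting `α t + β` for `t`.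
The result is kept as a formal polynomial because `aeval t` is not injective for an `A`-monomial, so
coefficients of ring elements would have no meaning. -/
theorem _root_.SymbolicSummation.IsAPSStep.exists_aeval_eq_shift {A B : Subring E} {t α β : E}
    {κ : MonomialKind} (h : IsAPSStep A B t α β κ) (σ : E ≃+* E) (hσA : ∀ a ∈ A, σ a ∈ A)
    (hσt : σ t = α * t + β) {d : ℕ} {F : A[X]} (hF : F.natDegree ≤ d) :
    ∃ F' : A[X], F'.natDegree ≤ d ∧ aeval t F' = σ (aeval t F) ∧
      (F'.coeff d : E) = α ^ d * σ (F.coeff d) ∧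
      (β = 0 → (F'.coeff 0 : E) = σ (F.coeff 0)) := by
  set L : A[X] := C ⟨α, h.shiftQuotient_mem⟩ * X + C ⟨β, h.shiftDifference_mem⟩ with hL
  have hL1 : L.natDegree ≤ 1 := natDegree_linear_le
  set s : A → A := fun a => ⟨σ a, hσA _ a.2⟩ with hs
  have hLt : aeval t L = σ t := by
    rw [hσt, hL, map_add, map_mul, aeval_C, aeval_C, aeval_X]
    rfl
  have hdeg : ∀ i, (L ^ i).natDegree ≤ i := fun i =>
    natDegree_pow_le.trans (by simpa using Nat.mul_le_mul_left i hL1)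
  refine ⟨∑ i ∈ Finset.range (d + 1), C (s (F.coeff i)) * L ^ i, ?_, ?_, ?_, ?_⟩
  · refine natDegree_sum_le_of_forall_le _ _ fun i hi => ?_
    exact (natDegree_C_mul_le _ _).trans ((hdeg i).trans (Nat.lt_succ_iff.mp
      (Finset.mem_range.mp hi)))
  · rw [aeval_eq_sum_range' (Nat.lt_succ_of_le hF), map_sum, map_sum]
    refine Finset.sum_congr rfl fun i _ => ?_
    rw [map_mul, map_pow, hLt, aeval_C, Algebra.smul_def, map_mul, map_pow]
    rfl
  · rw [finsetSum_coeff, Finset.sum_eq_single d]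
    · have h1 : (L ^ d).coeff d = (⟨α, h.shiftQuotient_mem⟩ : A) ^ d := by
        have := coeff_pow_of_natDegree_le (m := d) hL1
        rw [mul_one] at this
        rw [this, hL]
        simp
      rw [coeff_C_mul, h1, mul_comm]
      rfl
    · intro i hi hid
      have hi := Finset.mem_range.mp hi
      have h0 : (L ^ i).coeff d = 0 :=
        coeff_eq_zero_of_natDegree_lt (lt_of_le_of_lt (hdeg i) (by omega))
      rw [coeff_C_mul, h0, mul_zero]
    · simp
  · intro hβ
    subst hβ
    rw [finsetSum_coeff, Finset.sum_eq_single 0]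
    · simp [hs]
    · intro i _ hi
      rw [coeff_C_mul, coeff_zero_eq_eval_zero, eval_pow, hL]
      simp only [eval_add, eval_mul, eval_C, eval_X, mul_zero, zero_add]
      have : (⟨0, h.shiftDifference_mem⟩ : A) = 0 := rfl
      rw [this, zero_pow hi, mul_zero]
    · simp

/-- Among the nonzero elements of an invariant ideal choose one of least degree `d`. By simplicity
of `A` it may be taken monic, say `F`. If `d > 0`, then `σ(F) = α ^ d F` by minimality. For an
`S`-monomial `F` itself is then a constant, hence in `A`, which its degree forbids. Otherwise `F(0)
/ t ^ d` is a constant, hence in `A`, which forces `F(0) = 0`; then `F / t` contradicts minimality.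
-/
theorem _root_.SymbolicSummation.IsAPSStep.isShiftSimple {A B : Subring E} {t α β : E}
    {κ : MonomialKind} (h : IsAPSStep A B t α β κ) (σ : E ≃+* E) (hσA : ∀ a ∈ A, σ a ∈ A)
    (hσt : σ t = α * t + β) (hA : IsShiftSimple σ A) (hconst : ∀ c ∈ B, σ c = c → c ∈ A) :
    IsShiftSimple σ B := by
  classical
  intro I hIB hI hσI hne
  have hIA : ∀ a : A, ∀ x ∈ I, (a : E) * x ∈ I := fun a => hI a (h.base_le a.2)
  -- Degrees are measured on reduced polynomial representatives; in the Laurent case a power of `t`,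
  -- which is a unit, first removes the negative exponents.
  have hex : ∃ d, ∃ F : A[X], F.natDegree = d ∧ κ.DegreeAllowed d ∧ aeval t F ∈ I ∧
      aeval t F ≠ 0 := by
    obtain ⟨x, hx, hx0⟩ := hne
    obtain ⟨N, F, hN, hF⟩ := h.exists_aeval_eq (hIB x hx)
    obtain ⟨G, hG, hGF⟩ := h.exists_reduced F
    refine ⟨_, G, rfl, hG, ?_, ?_⟩
    · rw [hGF, ← hF, mul_comm]
      exact hI _ (pow_mem h.gen_mem N) x hx
    · rw [hGF, ← hF]
      rcases hN with rfl | rfl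
      · have hu : IsUnit t := h.compatible
        rwa [Ne, (hu.pow N).mul_left_eq_zero]
      · rwa [pow_zero, mul_one]
  set d := Nat.find hex with hd
  obtain ⟨F₀, hF₀d, hallow, hF₀I, hF₀0⟩ := Nat.find_spec hex
  rw [← hd] at hF₀d hallow
  have hmin : ∀ F : A[X], F.natDegree < d → aeval t F ∈ I → F = 0 := by
    intro F hF hFI
    refine h.eq_zero_of_aeval_eq_zero (hallow.mono hF.le) ?_
    by_contra h0
    exact Nat.find_min hex hF ⟨F, rfl, hallow.mono hF.le, hFI, h0⟩
  obtain ⟨α', hα', hαα'⟩ := h.exists_shiftQuotient_mul_eq_one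
  -- The coefficients of degree `d` form an ideal of `A`. Since σ multiplies such a coefficient by
  -- `α ^ d` besides acting on it, invariance uses the inverse `α'` of `α`.
  let J : AddSubgroup E :=
    { carrier := {a | ∃ F : A[X], F.natDegree ≤ d ∧ (F.coeff d : E) = a ∧ aeval t F ∈ I}
      zero_mem' := ⟨0, by simp, by simp, by simp [I.zero_mem]⟩
      add_mem' := by
        rintro _ _ ⟨F, hF, rfl, hFI⟩ ⟨G, hG, rfl, hGI⟩
        exact ⟨F + G, natDegree_add_le_of_degree_le hF hG, by simp,
          by rw [map_add]; exact I.add_mem hFI hGI⟩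
      neg_mem' := by
        rintro _ ⟨F, hF, rfl, hFI⟩
        exact ⟨-F, by simpa using hF, by simp, by rw [map_neg]; exact I.neg_mem hFI⟩ }
  have hJA : ∀ a ∈ A, ∀ x ∈ J, a * x ∈ J := by
    rintro a ha _ ⟨F, hF, rfl, hFI⟩
    refine ⟨C ⟨a, ha⟩ * F, (natDegree_C_mul_le _ _).trans hF, by simp, ?_⟩
    rw [map_mul, aeval_C]
    exact hIA ⟨a, ha⟩ _ hFI
  obtain ⟨F, hFd, hF1, hFI⟩ : (1 : E) ∈ J := by
    refine hA J ?_ hJA ?_ ⟨F₀.coeff d, ⟨F₀, hF₀d.le, rfl, hF₀I⟩, ?_⟩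
    · rintro _ ⟨F, -, rfl, -⟩
      exact (F.coeff d).2
    · rintro _ ⟨F, hF, rfl, hFI⟩
      obtain ⟨F', hF', hFe, hFc, -⟩ := h.exists_aeval_eq_shift σ hσA hσt hF
      have h1 := hJA _ (pow_mem hα' d) _ ⟨F', hF', rfl, by rw [hFe]; exact hσI _ hFI⟩
      rwa [hFc, ← mul_assoc, ← mul_pow, mul_comm α' α, hαα', one_pow, one_mul] at h1
    · intro h0
      have : F₀.leadingCoeff = 0 := by rw [leadingCoeff, hF₀d]; exact Subtype.ext h0
      rw [leadingCoeff_eq_zero.mp this, map_zero] at hF₀0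
      exact hF₀0 rfl
  have hF1 : F.coeff d = 1 := Subtype.ext hF1
  have : Nontrivial E := by
    obtain ⟨x, -, hx⟩ := hne
    exact ⟨x, 0, hx⟩
  rcases Nat.eq_zero_or_pos d with hd0 | hd0
  · rw [hd0] at hF1 hFd
    rw [eq_C_of_natDegree_le_zero hFd, hF1, map_one, map_one] at hFI
    exact hFI
  exfalso
  obtain ⟨F', hF', hFe, hFc, hFc0⟩ := h.exists_aeval_eq_shift σ hσA hσt hFd
  set a' : A := ⟨α', hα'⟩ with ha'
  -- Both sides have top coefficient 1 and value in `I`, so their difference has degree below `d`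
  -- and vanishes by `hmin`.
  have hFF' : F = C (a' ^ d) * F' := by
    have hle : (C (a' ^ d) * F' - F).natDegree ≤ d :=
      natDegree_sub_le_of_le ((natDegree_C_mul_le _ _).trans hF') hFd |>.trans (max_self d).le
    have hcoeff : (C (a' ^ d) * F' - F).coeff d = 0 := by
      rw [coeff_sub, coeff_C_mul, hF1, sub_eq_zero]
      apply Subtype.ext
      change α' ^ d * (F'.coeff d : E) = 1
      rw [hFc, hF1, ← mul_assoc, ← mul_pow, mul_comm α' α, hαα', one_pow, one_mul]
      exact map_one σ
    refine (sub_eq_zero.mp (hmin _ (lt_of_le_of_ne hle fun hEq => ?_) ?_)).symm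
    · have h0 : (C (a' ^ d) * F' - F).leadingCoeff = 0 := by rw [leadingCoeff, hEq, hcoeff]
      rw [leadingCoeff_eq_zero] at h0
      rw [h0, natDegree_zero] at hEq
      omega
    · rw [map_sub, map_mul, aeval_C, hFe]
      exact I.sub_mem (hIA (a' ^ d) _ (hσI _ hFI)) hFI
  by_cases hS : κ = .S
  · subst hS
    have hα1 : α = 1 := h.2.2.1
    rw [hα1, one_mul] at hαα'
    have ha1 : a' = 1 := Subtype.ext hαα'
    rw [ha1, one_pow, map_one, one_mul] at hFF'
    have hc := hconst _ (h.aeval_mem F) (by rw [← hFe, ← hFF'])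
    have h0 : F - C ⟨aeval t F, hc⟩ = 0 := h.eq_zero_of_aeval_eq_zero trivial (by
      rw [map_sub, aeval_C]
      exact sub_self _)
    have h1 := congrArg (fun p => coeff p d) h0
    simp only [coeff_sub, hF1, coeff_C_of_ne_zero hd0.ne', sub_zero, coeff_zero] at h1
    exact one_ne_zero h1
  · have hβ := h.shiftDifference_eq_zero hS
    obtain ⟨u, huB, htu⟩ := h.inverse_mem hS
    have hσu : σ u = α' * u := by
      have h1 : σ t * σ u = 1 := by rw [← map_mul, htu, map_one]
      rw [hσt, hβ, add_zero] at h1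
      linear_combination (α' * u) * h1 - σ u * α' * α * htu - σ u * hαα'
    have h0 : (F.coeff 0 : E) = α' ^ d * σ (F.coeff 0) := by
      conv_lhs => rw [hFF', coeff_C_mul]
      rw [← hFc0 hβ]
      rfl
    have hc := hconst ((F.coeff 0 : E) * u ^ d)
      (mul_mem (h.base_le (F.coeff 0).2) (pow_mem huB d)) (by
        rw [map_mul, map_pow, hσu]
        conv_rhs => rw [h0]
        ring)
    -- With `c = F(0) u ^ d` in `A`, the polynomial `F(0) - c X ^ d` vanishes at `t` and has an
    -- allowed degree, so it is zero; since `d > 0`, its constant term `F(0)` is zero.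
    have hP0 : C (F.coeff 0) - C ⟨_, hc⟩ * X ^ d = 0 := by
      refine h.eq_zero_of_aeval_eq_zero (hallow.mono ?_) ?_
      · refine natDegree_sub_le_of_le (m := d) ?_ (natDegree_C_mul_X_pow_le _ _) |>.trans
          (max_self d).le
        rw [natDegree_C]; exact hd0.le
      · rw [map_sub, map_mul, aeval_C, aeval_C, map_pow, aeval_X]
        change (F.coeff 0 : E) - (F.coeff 0 : E) * u ^ d * t ^ d = 0
        rw [mul_assoc, ← mul_pow, mul_comm u t, htu, one_pow, mul_one, sub_self]
    have hF00 : F.coeff 0 = 0 := by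
      have h1 := congrArg (fun p => coeff p 0) hP0
      simpa [hd0.ne] using h1
    have hdiv : F.divX * X = F := by
      have := divX_mul_X_add F
      rwa [hF00, map_zero, add_zero] at this
    have hdiv0 : F.divX = 0 := by
      refine hmin _ ?_ ?_
      · rw [natDegree_divX_eq_natDegree_tsub_one]; omega
      · have h1 : aeval t F.divX = u * aeval t F := by
          conv_rhs => rw [← hdiv, map_mul, aeval_X]
          linear_combination -aeval t F.divX * htu
        rw [h1]
        exact hI u huB _ hFI
    rw [← hdiv, hdiv0, zero_mul, coeff_zero] at hF1
    exact zero_ne_one hF1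

variable {G : Type*} [Field G] {σ₀ : G ≃+* G} [Algebra G E] {e : ℕ} (X : APSExtension σ₀ E e)

theorem isShiftSimple_tower (hX : X.IsRPiSigma) (i : Fin (e + 1)) :
    IsShiftSimple X.shift (X.tower i) := by
  induction i using Fin.induction with
  | zero =>
    rintro I hI hmul - ⟨x, hx, hx0⟩
    have hx' := hI x hx
    rw [X.tower_zero] at hx' hmul
    obtain ⟨a, rfl⟩ := hx'
    have ha : a ≠ 0 := by rintro rfl; exact hx0 (map_zero _)
    have := hmul (algebraMap G E a⁻¹) ⟨a⁻¹, rfl⟩ _ hx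
    rwa [← map_mul, inv_mul_cancel₀ ha, map_one] at this
  | succ i ih =>
    refine (X.step i).isShiftSimple X.shift (X.shift_mem_tower _) (X.shift_t i) ih ?_
    intro c _ hc
    have : c ∈ constants X.shift := hc
    rw [hX] at this
    obtain ⟨a, -, rfl⟩ := this
    exact X.algebraMap_mem_tower _ a

/-- A ring homomorphism whose kernel is shift-invariant is injective if there are no new
constants. -/
theorem injective_of_isRPiSigma (hX : X.IsRPiSigma) {R : Type*} [CommRing R] [Nontrivial R]
    (φ : E →+* R) (hφ : ∀ x, φ x = 0 → φ (X.shift x) = 0) : Function.Injective φ := by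
  rw [injective_iff_map_eq_zero]
  by_contra! hne
  obtain ⟨x, hx, hx0⟩ := hne
  have := X.isShiftSimple_tower hX (Fin.last e) (φ : E →+ R).ker
    (fun _ _ => by rw [X.tower_last]; trivial)
    (fun a _ y hy => by
      have hy : φ y = 0 := hy
      change φ (a * y) = 0
      rw [map_mul, hy, mul_zero])
    (fun y hy => hφ y hy) ⟨x, hx, hx0⟩
  exact one_ne_zero ((map_one φ).symm.trans this)

end Simple

/-! ### Ring homomorphisms from an APS-extension -/

section Hom

variable {G : Type*} [Field G] {σ₀ : G ≃+* G} {E : Type*} [CommRing E] [Algebra G E] {e : ℕ}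
  (X : APSExtension σ₀ E e)

/-- The exponent vectors of reduced representations. -/
def exponentVectors : Set (Fin e → ℤ) := {m | ∀ i, m i ∈ (X.kind i).exponents}

theorem exponentVectors_eq : X.exponentVectors = X.exponentsBelow (Fin.last e) := by
  ext m
  exact ⟨fun h => ⟨h, fun j hj => absurd hj (not_le.mpr (Fin.castSucc_lt_last j))⟩, fun h => h.1⟩

/-- The basis of power products. -/
def powerBasis : Module.Basis X.exponentVectors G E :=
  Module.Basis.mk (v := fun m : X.exponentVectors => powerProduct X.t m.1)
    (by
      rw [linearIndependent_iff']
      intro s g hs m hm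
      classical
      have key := X.coeff_eq_zero_of_sum_eq_zero (Fin.last e) (s.image Subtype.val)
        (fun m => if h : m ∈ X.exponentVectors then g ⟨m, h⟩ else 0)
        (fun m hm => by
          obtain ⟨m, -, rfl⟩ := Finset.mem_image.mp hm
          rw [← X.exponentVectors_eq]
          exact m.2) (by
          rw [Finset.sum_image Subtype.val_injective.injOn, ← hs]
          refine Finset.sum_congr rfl fun m _ => ?_
          rw [dif_pos m.2, Algebra.smul_def])
        m (Finset.mem_image_of_mem _ hm)
      rwa [dif_pos m.2] at key)
    (by
      intro f _
      have := X.tower_le_span (Fin.last e) f (by rw [X.tower_last]; trivial)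
      rwa [← X.exponentVectors_eq, Set.image_eq_range] at this)

theorem powerBasis_apply (m : X.exponentVectors) : X.powerBasis m = powerProduct X.t m.1 := by
  rw [powerBasis, Module.Basis.mk_apply]

/-- The exponent vector of a product of two power products. -/
def redAdd (m m' : X.exponentVectors) : X.exponentVectors :=
  ⟨fun i => (X.kind i).red (m.1 i + m'.1 i), fun i => (X.compatible i).red_mem (m.2 i) (m'.2 i)⟩

theorem powerProduct_redAdd {R : Type*} [CommRing R] {r : Fin e → R}
    (hr : ∀ i, (X.kind i).Compatible (r i)) (m m' : X.exponentVectors) :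
    powerProduct r (X.redAdd m m').1 = powerProduct r m.1 * powerProduct r m'.1 := by
  rw [powerProduct, powerProduct, powerProduct, ← Finset.prod_mul_distrib]
  exact Finset.prod_congr rfl fun i _ => (hr i).ringZPow_red (m.2 i) (m'.2 i)

/-- Ring homomorphisms can be defined by prescribing compatible images of the monomials. -/
theorem exists_ringHom {R : Type*} [CommRing R] (φ : G →+* R) {r : Fin e → R}
    (hr : ∀ i, (X.kind i).Compatible (r i)) :
    ∃ Φ : E →+* R, (∀ a, Φ (algebraMap G E a) = φ a) ∧ ∀ i, Φ (X.t i) = r i := by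
  let _ : Algebra G R := φ.toAlgebra
  let Φ : E →ₗ[G] R := X.powerBasis.constr G fun m => powerProduct r m.1
  have hΦ : ∀ m : X.exponentVectors, Φ (powerProduct X.t m.1) = powerProduct r m.1 := by
    intro m
    rw [← X.powerBasis_apply]
    exact X.powerBasis.constr_basis G _ m
  have h0 : (0 : Fin e → ℤ) ∈ X.exponentVectors := fun i => (X.compatible i).zero_mem
  have hone : Φ 1 = 1 := by
    have := hΦ ⟨0, h0⟩
    rwa [powerProduct_zero, powerProduct_zero] at this
  -- Multiplicativity is an identity of bilinear maps, so it suffices to check pairs of basis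
  -- elements, whose exponents add up to reduction.
  have hmul : (LinearMap.mul G E).compr₂ Φ = ((LinearMap.mul G R).comp Φ).compl₂ Φ := by
    refine X.powerBasis.ext fun m => X.powerBasis.ext fun m' => ?_
    rw [X.powerBasis_apply, X.powerBasis_apply]
    change Φ (powerProduct X.t m.1 * powerProduct X.t m'.1) =
      Φ (powerProduct X.t m.1) * Φ (powerProduct X.t m'.1)
    rw [← X.powerProduct_redAdd X.compatible, hΦ, hΦ, hΦ, X.powerProduct_redAdd hr]
  let Ψ : E →ₐ[G] R := AlgHom.ofLinearMap Φ hone fun x y =>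
    LinearMap.congr_fun (LinearMap.congr_fun hmul x) y
  refine ⟨Ψ.toRingHom, fun a => Ψ.commutes a, fun i => ?_⟩
  have := hΦ ⟨_, X.exponents_single (X.compatible i).one_mem⟩
  rwa [powerProduct_single, powerProduct_single, ringZPow_one, ringZPow_one] at this

variable {X} in
theorem map_powerProduct {R : Type*} [CommRing R] (Φ : E →+* R) {m : Fin e → ℤ}
    (hm : ∀ i, m i ∈ (X.kind i).exponents) :
    Φ (powerProduct X.t m) = powerProduct (fun i => Φ (X.t i)) m := by
  rw [powerProduct, map_prod]
  exact Finset.prod_congr rfl fun i _ => map_ringZPow Φ ((X.compatible i).isUnit_or_nonneg (hm i))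

/-- `IsBasic` speaks of α_i, while evaluations and expressions use σ⁻¹(α_i). The terms in
`P`-monomials below `i` are closed under products and inverses, and by induction they contain
σ⁻¹(t_j) for each of these monomials. -/
theorem IsBasic.exists_symm_eq (hX : X.IsBasic) {i : Fin e} (hi : X.kind i = .P) :
    ∃ (h : G) (m : Fin e → ℤ), h ≠ 0 ∧ (∀ j, m j ≠ 0 → j < i ∧ X.kind j = .P) ∧
      X.shift.symm (X.α i) = algebraMap G E h * powerProduct X.t m := by
  classical
  induction i using WellFoundedLT.induction with | _ i ih
  obtain ⟨h, m, hh, hm, hα⟩ : ∃ (h : G) (m : Fin e → ℤ), h ≠ 0 ∧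
      (∀ j, m j ≠ 0 → j < i ∧ X.kind j = .P) ∧
      X.α i = algebraMap G E h * ∏ j, ringZPow (X.t j) (m j) := by
    have := hX i
    rw [hi] at this
    exact this
  -- the set of terms in the `P`-monomials below `i` is closed under products
  let S : Set E := {f | ∃ (h : G) (m : Fin e → ℤ), h ≠ 0 ∧
    (∀ j, m j ≠ 0 → j < i ∧ X.kind j = .P) ∧ f = algebraMap G E h * powerProduct X.t m}
  have hunit : ∀ {j : Fin e}, X.kind j = .P → IsUnit (X.t j) := fun {j} hj =>
    (X.compatible j).isUnit (by rw [hj]; simp)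
  have hSmul : ∀ f ∈ S, ∀ g ∈ S, f * g ∈ S := by
    rintro _ ⟨h, m, hh, hm, rfl⟩ _ ⟨h', m', hh', hm', rfl⟩
    refine ⟨h * h', m + m', mul_ne_zero hh hh', ?_, ?_⟩
    · intro j hj
      by_cases h0 : m j = 0
      · exact hm' j (by simpa [h0] using hj)
      · exact hm j h0
    · have : powerProduct X.t (m + m') = powerProduct X.t m * powerProduct X.t m' := by
        rw [powerProduct, powerProduct, powerProduct, ← Finset.prod_mul_distrib]
        refine Finset.prod_congr rfl fun j _ => ?_
        rw [Pi.add_apply]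
        by_cases h0 : m j = 0
        · rw [h0, zero_add, ringZPow_zero, one_mul]
        · exact ringZPow_add (hunit (hm j h0).2) _ _
      rw [this, map_mul]
      ring
  have hS1 : (1 : E) ∈ S := ⟨1, 0, one_ne_zero, fun j hj => absurd rfl hj, by
    rw [powerProduct_zero, map_one, one_mul]⟩
  have hSinv : ∀ f ∈ S, ∃ g ∈ S, f * g = 1 := by
    rintro _ ⟨h, m, hh, hm, rfl⟩
    refine ⟨_, ⟨h⁻¹, -m, inv_ne_zero hh, fun j hj => hm j (by simpa using hj), rfl⟩, ?_⟩
    have : powerProduct X.t m * powerProduct X.t (-m) = 1 := by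
      rw [powerProduct, powerProduct, ← Finset.prod_mul_distrib]
      refine Finset.prod_eq_one fun j _ => ?_
      rw [Pi.neg_apply]
      by_cases h0 : m j = 0
      · rw [h0, neg_zero, ringZPow_zero, one_mul]
      · rw [← ringZPow_add (hunit (hm j h0).2), add_neg_cancel, ringZPow_zero]
    rw [mul_mul_mul_comm, this, mul_one, ← map_mul, mul_inv_cancel₀ hh, map_one]
  have hSunit : ∀ f : E, ∀ u, f * u = 1 → f ∈ S → u ∈ S := by
    intro f u hu hf
    obtain ⟨g, hg, hfg⟩ := hSinv f hf
    have : u = g := by linear_combination g * hu - u * hfg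
    rwa [this]
  have hSpow : ∀ f ∈ S, ∀ z : ℤ, ringZPow f z ∈ S := by
    have hpow : ∀ f ∈ S, ∀ n : ℕ, f ^ n ∈ S := by
      intro f hf n
      induction n with
      | zero => rwa [pow_zero]
      | succ n ihn => rw [pow_succ]; exact hSmul _ ihn _ hf
    intro f hf z
    obtain ⟨g, hg, hfg⟩ := hSinv f hf
    have hu : IsUnit f := IsUnit.of_mul_eq_one _ hfg
    rcases le_or_gt 0 z with hz | hz
    · rw [ringZPow_of_nonneg _ hz]
      exact hpow f hf _
    · have h1 := ringZPow_add hu (-z) z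
      rw [neg_add_cancel, ringZPow_zero, ringZPow_of_nonneg _ (by omega : 0 ≤ -z)] at h1
      exact hSunit _ _ h1.symm (hpow f hf _)
  have hSt : ∀ j, j < i → X.kind j = .P → X.t j ∈ S := fun j hj hP =>
    ⟨1, Function.update 0 j 1, one_ne_zero, fun j' hj' => by
      by_cases hjj : j' = j
      · subst hjj; exact ⟨hj, hP⟩
      · simp [hjj] at hj', by rw [powerProduct_single, map_one, one_mul, ringZPow_one]⟩
  -- The quotient of `t_j` by σ⁻¹(α_j), which is such a term by the induction hypothesis.
  have hSσ : ∀ j, j < i → X.kind j = .P → X.shift.symm (X.t j) ∈ S := by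
    intro j hj hP
    have hα' : X.shift.symm (X.α j) ∈ S := by
      obtain ⟨h, m, hh, hm, hα⟩ := ih j hj hP
      exact ⟨h, m, hh, fun j' hj' => ⟨(hm j' hj').1.trans hj, (hm j' hj').2⟩, hα⟩
    have hβ := (X.step j).shiftDifference_eq_zero (by rw [hP]; simp)
    have h1 : X.shift.symm (X.α j) * X.shift.symm (X.t j) = X.t j := by
      rw [← map_mul, ← add_zero (X.α j * X.t j), ← hβ, ← X.shift_t, RingEquiv.symm_apply_apply]
    obtain ⟨g, hg, hag⟩ := hSinv _ hα'
    have : X.shift.symm (X.t j) = g * X.t j := by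
      linear_combination g * h1 - X.shift.symm (X.t j) * hag
    rw [this]
    exact hSmul _ hg _ (hSt j hj hP)
  have hmem : X.shift.symm (X.α i) ∈ S := by
    rw [hα, map_mul, map_prod]
    refine hSmul _ ⟨σ₀.symm h, 0, ?_, fun j hj => absurd rfl hj, ?_⟩ _ ?_
    · simpa using hh
    · rw [powerProduct_zero, mul_one, RingEquiv.symm_apply_eq, X.shift_algebraMap,
        RingEquiv.apply_symm_apply]
    · have : ∀ s : Finset (Fin e), ∏ j ∈ s, X.shift.symm (ringZPow (X.t j) (m j)) ∈ S := by
        intro s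
        induction s using Finset.induction_on with
        | empty => rwa [Finset.prod_empty]
        | insert j s hj ihs =>
          rw [Finset.prod_insert hj]
          refine hSmul _ ?_ _ ihs
          by_cases h0 : m j = 0
          · rw [h0, ringZPow_zero, map_one]; exact hS1
          · have := map_ringZPow X.shift.symm.toRingHom (z := m j) (Or.inl (hunit (hm j h0).2))
            have h2 : X.shift.symm (ringZPow (X.t j) (m j)) =
              ringZPow (X.shift.symm (X.t j)) (m j) := this
            rw [h2]
            exact hSpow _ (hSσ j (hm j h0).1 (hm j h0).2) _
      exact this _
  exact hmem

end Hom

end APSExtension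

/-- The infimum in `nonzeroFrom` would be 0 for an empty set; `hnz` makes the set nonempty, so the
infimum is attained. -/
theorem groundEval_ne_zero {kd : GroundKind} {K : Type*} [Field K] {v : ℕ} {q : Fin v → Kˣ}
    (hnz : EventuallyNonzero kd q) {f : GroundField kd K v} (hf : f ≠ 0) {n : ℕ}
    (hn : groundZ kd q f ≤ n) : groundEval kd q f n ≠ 0 := by
  have key : ∀ p : GroundPoly kd K v, p ≠ 0 → nonzeroFrom kd q p ≤ n → polyEval kd q p n ≠ 0 := by
    intro p hp hpn
    have := Nat.sInf_mem (s := {δ : ℕ | ∀ n, δ ≤ n → polyEval kd q p n ≠ 0}) (hnz p hp)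
    exact this n hpn
  have h1 := key _ (nonZeroDivisors.coe_ne_zero (IsFractionRing.den (GroundPoly kd K v) f))
    ((le_max_right _ _).trans hn)
  have h2 := key (IsFractionRing.num (GroundPoly kd K v) f)
    (fun h0 => hf (IsFractionRing.eq_zero_of_num_eq_zero h0)) ((le_max_left _ _).trans hn)
  rw [groundEval, if_neg h1]
  exact div_ne_zero h2 h1

namespace APSExtension

variable {kd : GroundKind} {K : Type*} [Field K] {v : ℕ} {q : Fin v → Kˣ}
  {E : Type*} [CommRing E] [Algebra (GroundField kd K v) E] {e : ℕ}
  (X : APSExtension (groundShift kd q) E e) (l : Fin e → ℕ)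

/-! ### The evaluation of monomials -/

theorem evWith_congr {i : Fin (e + 1)} {f : E} (hf : f ∈ X.tower i) {g g' : Fin e → ℕ → K} {n : ℕ}
    (h : ∀ j : Fin e, j.castSucc < i → g j n = g' j n) : X.evWith g f n = X.evWith g' f n := by
  refine Finset.sum_congr rfl fun m hm => ?_
  refine congrArg _ (Finset.prod_congr rfl fun j _ => ?_)
  by_cases hj : j.castSucc < i
  · rw [h j hj]
  · rw [(X.support_reducedRep_subset hf m hm).2 j (not_lt.mp hj), zpow_zero, zpow_zero]

/-- The dummy value 1 in the recursion is given to monomials that do not occur in `f`, so it can be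
replaced by their true values. -/
theorem evWith_truncate {i : Fin e} {f : E} (hf : f ∈ X.tower i.castSucc) (n : ℕ) :
    X.evWith (fun j k' => if _h : j < i then X.evMonomial l j k' else 1) f n = X.ev l f n := by
  refine X.evWith_congr hf fun j hj => ?_
  rw [dif_pos (Fin.castSucc_lt_castSucc_iff.mp hj)]

theorem symm_shiftQuotient_mem (i : Fin e) : X.shift.symm (X.α i) ∈ X.tower i.castSucc :=
  X.shift_symm_mem_tower _ _ (X.step i).shiftQuotient_mem

theorem symm_shiftDifference_mem (i : Fin e) : X.shift.symm (X.β i) ∈ X.tower i.castSucc :=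
  X.shift_symm_mem_tower _ _ (X.step i).shiftDifference_mem

theorem evMonomial_eq_sum {i : Fin e} (hi : X.kind i = .S) (n : ℕ) :
    X.evMonomial l i n = ∑ k ∈ Finset.Icc (l i) n, X.ev l (X.shift.symm (X.β i)) k := by
  rw [evMonomial]
  simp only [hi]
  exact Finset.sum_congr rfl fun k _ => X.evWith_truncate l (X.symm_shiftDifference_mem i) k

theorem evMonomial_eq_prod {i : Fin e} (hi : X.kind i ≠ .S) (n : ℕ) :
    X.evMonomial l i n = ∏ k ∈ Finset.Icc (l i) n, X.ev l (X.shift.symm (X.α i)) k := by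
  rw [evMonomial]
  rcases h : X.kind i with ν | _ | _
  · exact Finset.prod_congr rfl fun k _ => X.evWith_truncate l (X.symm_shiftQuotient_mem i) k
  · exact Finset.prod_congr rfl fun k _ => X.evWith_truncate l (X.symm_shiftQuotient_mem i) k
  · exact absurd h hi

theorem ev_term (a : GroundField kd K v) {m : Fin e → ℤ} (hm : ∀ i, m i ∈ (X.kind i).exponents)
    (n : ℕ) : X.ev l (algebraMap _ E a * powerProduct X.t m) n =
      groundEval kd q a n * ∏ j, X.evMonomial l j n ^ m j := by
  rw [ev, evWith, X.reducedRep_term hm, Finsupp.sum_single_index]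
  rw [groundEval_zero, zero_mul]

theorem ev_t (i : Fin e) (n : ℕ) : X.ev l (X.t i) n = X.evMonomial l i n := by
  have := X.ev_term l 1 (X.exponents_single (X.compatible i).one_mem) n
  rw [powerProduct_single, map_one, one_mul, ringZPow_one, groundEval_one, one_mul] at this
  rw [this, Finset.prod_eq_single i]
  · rw [Function.update_self, zpow_one]
  · intro j _ hj
    rw [Function.update_of_ne hj, Pi.zero_apply, zpow_zero]
  · simp

variable {X l}

theorem exists_base_eq (hX : X.IsBasic) {i : Fin e} {ν : ℕ} (hi : X.kind i = .A ν) :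
    ∃ c : K, X.α i = algebraMap _ E (algebraMap K (GroundField kd K v) c) ∧
      IsPrimitiveRoot c ν ∧ X.shift.symm (X.α i) = X.α i := by
  have hs := X.step i
  rw [hi] at hs
  obtain ⟨hν, -, -, -, hpr, -⟩ := hs
  obtain ⟨a, -, hσa, ha⟩ : ∃ a : GroundField kd K v, a ≠ 0 ∧ groundShift kd q a = a ∧
      X.α i = algebraMap _ E a := by
    have := hX i
    rw [hi] at this
    exact this
  rw [ha] at hpr
  have hpa : IsPrimitiveRoot a ν := hpr.of_map_of_injective X.algebraMap_injective
  obtain ⟨c, rfl⟩ := exists_algebraMap_eq_of_pow_eq_one (by omega) hpa.pow_eq_one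
  refine ⟨c, ha, hpa.of_map_of_injective (algebraMap K (GroundField kd K v)).injective, ?_⟩
  rw [ha, RingEquiv.symm_apply_eq, X.shift_algebraMap, hσa]

theorem toBase_algebraMap (X : APSExtension (groundShift kd q) E e) (c : K) :
    toBase (kd := kd) (v := v) (algebraMap _ E (algebraMap K (GroundField kd K v) c)) = c := by
  refine Function.leftInverse_invFun (f := fun c : K =>
    algebraMap (GroundField kd K v) E (algebraMap K (GroundField kd K v) c)) ?_ c
  exact X.algebraMap_injective.comp (algebraMap K (GroundField kd K v)).injective

/-- The lower bound 1 yields exactly `n` equal factors, so the product is the `n`-th power for `n =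
0` as well. -/
theorem evMonomial_root (hX : X.IsBasic) (hl : X.IsLowerBounds l) {i : Fin e} {ν : ℕ}
    (hi : X.kind i = .A ν) (n : ℕ) :
    X.evMonomial l i n = toBase (kd := kd) (v := v) (X.α i) ^ n := by
  obtain ⟨c, hc, -, hσ⟩ := exists_base_eq hX hi
  have hli : l i = 1 := by
    have := hl i
    rw [hi] at this
    exact this
  rw [X.evMonomial_eq_prod l (by rw [hi]; simp), hσ, hc, toBase_algebraMap X, hli]
  have : ∀ k, X.ev l (algebraMap _ E (algebraMap K (GroundField kd K v) c)) k = c := by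
    intro k
    have := X.ev_term l (algebraMap K (GroundField kd K v) c) (m := 0)
      (fun i => (X.compatible i).zero_mem) k
    rw [powerProduct_zero, mul_one] at this
    rw [this, groundEval_algebraMap]
    simp
  simp [this]

theorem groundZ_le (hl : X.IsLowerBounds l) {i : Fin e} (hi : X.kind i = .P)
    {m : Fin e → ℤ} (hm : m ∈ (X.reducedRep (X.shift.symm (X.α i))).support) :
    groundZ kd q (X.reducedRep (X.shift.symm (X.α i)) m) ≤ l i := by
  have h1 : max (X.oFun l (X.shift.symm (X.α i))) (X.zFun (X.shift.symm (X.α i))) ≤ l i := by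
    have := hl i
    rw [hi] at this
    exact this
  refine le_trans ?_ ((le_max_right _ _).trans h1)
  exact Finset.le_sup (f := fun m => groundZ kd q (X.reducedRep (X.shift.symm (X.α i)) m)) hm

theorem IsBasic.exists_reducedRep_eq (hX : X.IsBasic) {i : Fin e} (hi : X.kind i = .P) :
    ∃ (h : GroundField kd K v) (m : Fin e → ℤ), h ≠ 0 ∧
      (∀ j, m j ≠ 0 → j < i ∧ X.kind j = .P) ∧ (∀ j, m j ∈ (X.kind j).exponents) ∧
      X.shift.symm (X.α i) = algebraMap _ E h * powerProduct X.t m ∧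
      X.reducedRep (X.shift.symm (X.α i)) = Finsupp.single m h := by
  obtain ⟨h, m, hh, hm, hα⟩ := IsBasic.exists_symm_eq X hX hi
  have hm' : ∀ j, m j ∈ (X.kind j).exponents := by
    intro j
    by_cases h0 : m j = 0
    · rw [h0]; exact (X.compatible j).zero_mem
    · rw [(hm j h0).2]; trivial
  exact ⟨h, m, hh, hm, hm', hα, by rw [hα, X.reducedRep_term hm']⟩

/-- Each factor has index `k ≥ l i ≥ Z(h)`, so its ground part is nonzero, and the `P`-monomials in
it are nonzero by induction. Below `l i` the product is empty. Thus negative powers are meaningful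
for every `n`. -/
theorem evMonomial_ne_zero (hnz : EventuallyNonzero kd q) (hX : X.IsBasic)
    (hl : X.IsLowerBounds l) {i : Fin e} (hi : X.kind i = .P) (n : ℕ) :
    X.evMonomial l i n ≠ 0 := by
  classical
  induction i using WellFoundedLT.induction generalizing n with | _ i ih
  rw [X.evMonomial_eq_prod l (by rw [hi]; simp)]
  refine Finset.prod_ne_zero_iff.mpr fun k hk => ?_
  obtain ⟨h, m, hh, hm, hm', hα, hrep⟩ := hX.exists_reducedRep_eq hi
  rw [hα, X.ev_term l h hm']
  refine mul_ne_zero (groundEval_ne_zero hnz hh ?_) (Finset.prod_ne_zero_iff.mpr fun j _ => ?_)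
  · have := groundZ_le hl hi (m := m) (by rw [hrep]; simpa using hh)
    rw [hrep, Finsupp.single_eq_same] at this
    exact this.trans (Finset.mem_Icc.mp hk).1
  · by_cases h0 : m j = 0
    · rw [h0, zpow_zero]; exact one_ne_zero
    · exact zpow_ne_zero _ (ih j (hm j h0).1 (hm j h0).2 k)

/-- The sequences of the monomials satisfy the relations of the monomials. -/
theorem compatible_evMonomial (hnz : EventuallyNonzero kd q) (hX : X.IsBasic)
    (hl : X.IsLowerBounds l) (i : Fin e) : (X.kind i).Compatible (X.evMonomial l i) := by
  rcases h : X.kind i with ν | _ | _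
  · have hc := X.compatible i
    rw [h] at hc
    refine ⟨hc.1, funext fun n => ?_⟩
    obtain ⟨c, hα, hpr, -⟩ := exists_base_eq hX h
    rw [Pi.pow_apply, evMonomial_root hX hl h, hα, toBase_algebraMap X, ← pow_mul, mul_comm,
      pow_mul, hpr.pow_eq_one, one_pow]
    rfl
  · exact Pi.isUnit_iff.mpr fun n => (evMonomial_ne_zero hnz hX hl h n).isUnit
  · trivial

theorem _root_.SymbolicSummation.MonomialKind.Compatible.map {κ : MonomialKind} {R R' : Type*}
    [CommRing R] [CommRing R'] (φ : R →+* R') {r : R} (h : κ.Compatible r) :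
    κ.Compatible (φ r) := by
  cases κ with
  | A ν => exact ⟨h.1, by rw [← map_pow, h.2, map_one]⟩
  | P => exact IsUnit.map φ h
  | S => trivial

/-- `τ` is a ring homomorphism that commutes with the shifts. -/
theorem exists_tauHom (hnz : EventuallyNonzero kd q) (hX : X.IsBasic)
    (hl : X.IsLowerBounds l) :
    ∃ Φ : E →+* SeqRing K, (∀ f, Φ f = X.tau l f) ∧
      (∀ f, Φ (X.shift f) = seqShift (Φ f)) ∧
      ∀ c : K, Φ (algebraMap _ E (algebraMap K (GroundField kd K v) c)) =
        ((fun _ => c : ℕ → K) : SeqRing K) := by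
  obtain ⟨φ, hφ, hφσ, hφc⟩ := exists_groundHom hnz
  let π : (ℕ → K) →+* SeqRing K := Filter.Germ.coeRingHom Filter.atTop
  have hc := compatible_evMonomial hnz hX hl
  obtain ⟨Φ, hΦa, hΦt⟩ := X.exists_ringHom φ fun i => (hc i).map π
  have hΦ : ∀ f, Φ f = X.tau l f := by
    intro f
    conv_lhs => rw [X.eq_sum_reducedRep f]
    -- The evaluation is rewritten in the ring of genuine sequences, where the powers in `ev` become
    -- the ring powers that `π` respects.
    have : X.ev l f = ∑ m ∈ (X.reducedRep f).support,
        groundEval kd q (X.reducedRep f m) * powerProduct (X.evMonomial l) m := by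
      funext n
      rw [Finset.sum_apply]
      refine Finset.sum_congr rfl fun m hm => ?_
      rw [Pi.mul_apply, powerProduct, Finset.prod_apply]
      refine congrArg _ (Finset.prod_congr rfl fun j _ => ?_)
      have := map_ringZPow (Pi.evalRingHom (fun _ : ℕ => K) n)
        ((hc j).isUnit_or_nonneg (X.exponents_of_mem_support hm j))
      rw [← ringZPow_eq_zpow]
      exact this.symm
    change _ = π (X.ev l f)
    rw [this, map_sum, map_sum]
    refine Finset.sum_congr rfl fun m hm => ?_
    rw [map_mul, map_mul, hΦa, hφ, map_powerProduct Φ (X.exponents_of_mem_support hm),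
      powerProduct, powerProduct, map_prod]
    congr 1
    refine Finset.prod_congr rfl fun j _ => ?_
    rw [hΦt]
    exact (map_ringZPow π ((hc j).isUnit_or_nonneg (X.exponents_of_mem_support hm j))).symm
  refine ⟨Φ, hΦ, ?_, fun c => by rw [hΦa, hφc]⟩
  have key : ∀ i, ∀ f ∈ X.tower i, Φ (X.shift f) = seqShift (Φ f) := by
    intro i
    induction i using Fin.induction with
    | zero =>
      intro f hf
      rw [X.tower_zero] at hf
      obtain ⟨a, rfl⟩ := hf
      rw [X.shift_algebraMap, hΦa, hΦa, hφσ]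
    | succ i ih =>
      have hs := X.step i
      -- This explains the σ⁻¹ in the definitions: passing from `n` to `n + 1` appends the value of
      -- σ⁻¹(α) or σ⁻¹(β) at `n + 1`, which is the value of α or β at `n` for large `n`.
      have hΦσ : ∀ f ∈ X.tower i.castSucc,
          Φ f = ((fun n => X.ev l (X.shift.symm f) (n + 1) : ℕ → K) : SeqRing K) := by
        intro f hf
        rw [← seqShift_coe (X.ev l (X.shift.symm f))]
        change Φ f = seqShift (X.tau l (X.shift.symm f))
        rw [← hΦ, ← ih _ (X.shift_symm_mem_tower _ _ hf), RingEquiv.apply_symm_apply]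
      have ht : Φ (X.shift (X.t i)) = seqShift (Φ (X.t i)) := by
        rw [X.shift_t, map_add, map_mul, hΦt]
        have hsucc : seqShift (π (X.evMonomial l i)) =
            ((fun n => X.evMonomial l i (n + 1) : ℕ → K) : SeqRing K) := rfl
        rw [hsucc]
        by_cases hS : X.kind i = .S
        · have hα : X.α i = 1 := by rw [hS] at hs; exact hs.2.2.1
          rw [hα, map_one, one_mul, hΦσ _ hs.shiftDifference_mem]
          change ((X.evMonomial l i : ℕ → K) : SeqRing K) + _ = _
          rw [← Filter.Germ.coe_add, Filter.Germ.coe_eq]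
          refine Filter.eventually_atTop.mpr ⟨l i, fun n hn => ?_⟩
          simp only [Pi.add_apply]
          rw [X.evMonomial_eq_sum l hS, X.evMonomial_eq_sum l hS,
            Finset.sum_Icc_succ_top (by omega)]
        · rw [hs.shiftDifference_eq_zero hS, map_zero, add_zero, hΦσ _ hs.shiftQuotient_mem]
          change _ * ((X.evMonomial l i : ℕ → K) : SeqRing K) = _
          rw [← Filter.Germ.coe_mul, Filter.Germ.coe_eq]
          refine Filter.eventually_atTop.mpr ⟨l i, fun n hn => ?_⟩
          simp only [Pi.mul_apply]
          rw [X.evMonomial_eq_prod l hS, X.evMonomial_eq_prod l hS,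
            Finset.prod_Icc_succ_top (by omega), mul_comm]
      -- The two homomorphisms agree on `t`, and therefore on its inverse, since inverses are
      -- unique.
      refine hs.le_of_mem (S := RingHom.eqLocus (Φ.comp X.shift.toRingHom)
        ((seqShiftHom K).comp Φ)) ih ht ?_
      intro _ u hu
      have h1 : Φ (X.shift (X.t i)) * Φ (X.shift u) = 1 := by
        rw [← map_mul, ← map_mul, hu, map_one, map_one]
      have h2 : seqShiftHom K (Φ (X.t i)) * seqShiftHom K (Φ u) = 1 := by
        rw [← map_mul, ← map_mul, hu, map_one, map_one]
      have h3 : seqShiftHom K (Φ (X.t i)) = Φ (X.shift (X.t i)) := ht.symm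
      rw [h3] at h2
      change Φ (X.shift u) = seqShiftHom K (Φ u)
      linear_combination seqShiftHom K (Φ u) * h1 - Φ (X.shift u) * h2
  intro f
  exact key (Fin.last e) f (by rw [X.tower_last]; trivial)

end APSExtension

namespace SPExpr

/-! ### Evaluation of expressions and permutations of operands -/

section Lists

variable {kd : GroundKind} {K : Type*} [Field K] {v : ℕ} (q : Fin v → Kˣ)

theorem eval_addList (L : List (SPExpr (GroundField kd K v) K)) (n : ℕ) :
    eval kd q (addList L) n = (L.map fun a => eval kd q a n).sum := by
  have key : ∀ (L : List (SPExpr (GroundField kd K v) K)) (a : SPExpr (GroundField kd K v) K),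
      eval kd q (L.foldl add a) n = eval kd q a n + (L.map fun a => eval kd q a n).sum := by
    intro L
    induction L with
    | nil => intro a; simp
    | cons b L ih => intro a; simp [ih, eval, add_assoc]
  cases L with
  | nil => simp [addList, eval, groundEval_zero]
  | cons a L => simp [addList, key]

theorem eval_mulList (L : List (SPExpr (GroundField kd K v) K)) (n : ℕ) :
    eval kd q (mulList L) n = (L.map fun a => eval kd q a n).prod := by
  have key : ∀ (L : List (SPExpr (GroundField kd K v) K)) (a : SPExpr (GroundField kd K v) K),
      eval kd q (L.foldl mul a) n = eval kd q a n * (L.map fun a => eval kd q a n).prod := by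
    intro L
    induction L with
    | nil => intro a; simp
    | cons b L ih => intro a; simp [ih, eval, mul_assoc]
  cases L with
  | nil => simp [mulList, eval, groundEval_one]
  | cons a L => simp [mulList, key]

theorem eval_ofData (D : List (GroundField kd K v × List (SPExpr (GroundField kd K v) K × ℤ)))
    (n : ℕ) : eval kd q (ofData D) n = (D.map fun x => groundEval kd q x.1 n *
      (x.2.map fun y => eval kd q y.1 n ^ y.2).prod).sum := by
  rw [ofData, eval_addList, List.map_map]
  congr 1
  refine List.map_congr_left fun x _ => ?_
  rw [Function.comp_apply, eval, eval, eval_mulList, List.map_map]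
  rfl

theorem eval_ofData_eq {D D' : List (GroundField kd K v × List (SPExpr (GroundField kd K v) K × ℤ))}
    (h : DataPerm D D') (n : ℕ) : eval kd q (ofData D) n = eval kd q (ofData D') n := by
  obtain ⟨D'', h1, h2⟩ := h
  rw [eval_ofData, eval_ofData, (h1.map _).sum_eq]
  congr 1
  clear h1
  induction h2 with
  | nil => rfl
  | cons hxy _ ih =>
    rw [List.map_cons, List.map_cons, ih, hxy.1, (hxy.2.map _).prod_eq]

theorem mulList_induction {p : SPExpr (GroundField kd K v) K → Prop} (h1 : p (elem 1))
    (hmul : ∀ a b, p a → p b → p (mul a b)) (L : List (SPExpr (GroundField kd K v) K))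
    (hL : ∀ a ∈ L, p a) : p (mulList L) := by
  have key : ∀ (L : List (SPExpr (GroundField kd K v) K)) (a : SPExpr (GroundField kd K v) K),
      p a → (∀ a ∈ L, p a) → p (L.foldl mul a) := by
    intro L
    induction L with
    | nil => intro a ha _; exact ha
    | cons b L ih =>
      intro a ha hL
      exact ih _ (hmul _ _ ha (hL b (by simp))) fun c hc => hL c (by simp [hc])
  cases L with
  | nil => exact h1
  | cons a L => exact key L a (hL a (by simp)) fun c hc => hL c (by simp [hc])

theorem addList_induction {p : SPExpr (GroundField kd K v) K → Prop} (h0 : p (elem 0))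
    (hadd : ∀ a b, p a → p b → p (add a b)) (L : List (SPExpr (GroundField kd K v) K))
    (hL : ∀ a ∈ L, p a) : p (addList L) := by
  have key : ∀ (L : List (SPExpr (GroundField kd K v) K)) (a : SPExpr (GroundField kd K v) K),
      p a → (∀ a ∈ L, p a) → p (L.foldl add a) := by
    intro L
    induction L with
    | nil => intro a ha _; exact ha
    | cons b L ih =>
      intro a ha hL
      exact ih _ (hadd _ _ ha (hL b (by simp))) fun c hc => hL c (by simp [hc])
  cases L with
  | nil => exact h0
  | cons a L => exact key L a (hL a (by simp)) fun c hc => hL c (by simp [hc])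

/-- A nonempty list produces an expression whose outermost constructor is `mul` or `add`. -/
theorem eq_nil_of_ofData_eq_elem
    {D : List (GroundField kd K v × List (SPExpr (GroundField kd K v) K × ℤ))}
    {g : GroundField kd K v} (h : ofData D = elem g) : D = [] := by
  have key : ∀ (L : List (SPExpr (GroundField kd K v) K)) (a : SPExpr (GroundField kd K v) K),
      (∀ g, a ≠ elem g) → ∀ g, L.foldl add a ≠ elem g := by
    intro L
    induction L with
    | nil => intro a ha; exact ha
    | cons b L ih => intro a _; exact ih _ (fun g => by simp)
  cases D with
  | nil => rfl
  | cons x D => exact absurd h (key _ _ (fun g => by simp) g)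

end Lists

section DataPerm

variable {G K : Type*}

/-- The relation between single summands in `DataPerm`. -/
def TermPerm (x y : G × List (SPExpr G K × ℤ)) : Prop := x.1 = y.1 ∧ x.2.Perm y.2

/-- Permuting factors inside summands commutes with permuting the summands; symmetry and
transitivity of `DataPerm` rest on this. -/
theorem dataPerm_of_forall₂_of_perm {D D' D'' : List (G × List (SPExpr G K × ℤ))}
    (h : List.Forall₂ TermPerm D D') (h' : D'.Perm D'') : DataPerm D D'' := by
  have : Relation.Comp (List.Forall₂ TermPerm) List.Perm D D'' := ⟨D', h, h'⟩
  rw [List.forall₂_comp_perm_eq_perm_comp_forall₂] at this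
  exact this

theorem DataPerm.symm {D D' : List (G × List (SPExpr G K × ℤ))} (h : DataPerm D D') :
    DataPerm D' D := by
  obtain ⟨D'', h1, h2⟩ := h
  refine dataPerm_of_forall₂_of_perm (List.Forall₂.flip ?_) h1.symm
  exact h2.imp fun x y hxy => ⟨hxy.1.symm, hxy.2.symm⟩

theorem DataPerm.trans {D₁ D₂ D₃ : List (G × List (SPExpr G K × ℤ))} (h : DataPerm D₁ D₂)
    (h' : DataPerm D₂ D₃) : DataPerm D₁ D₃ := by
  obtain ⟨D, h1, h2⟩ := h
  obtain ⟨D', h3, h4⟩ := h'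
  obtain ⟨D'', h5, h6⟩ := dataPerm_of_forall₂_of_perm h2 h3
  refine ⟨D'', h1.trans h5, ?_⟩
  clear h1 h2 h3 h5
  induction h6 generalizing D₃ with
  | nil => exact h4
  | cons hxy _ ih =>
    cases h4 with
    | cons hyz h4 =>
      exact List.Forall₂.cons ⟨hxy.1.trans hyz.1, hxy.2.trans hyz.2⟩ (ih h4)

/-- The list of factors of a power product with exponents `m`. -/
def termData {e : ℕ} (T : Fin e → SPExpr G K) (m : Fin e → ℤ) : List (SPExpr G K × ℤ) :=
  ((List.finRange e).filter fun j => decide (m j ≠ 0)).map fun j => (T j, m j)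

theorem mem_termData {e : ℕ} {T : Fin e → SPExpr G K} {m : Fin e → ℤ} {y : SPExpr G K × ℤ} :
    y ∈ termData T m ↔ ∃ j, m j ≠ 0 ∧ y = (T j, m j) := by
  rw [termData, List.mem_map]
  constructor
  · rintro ⟨j, hj, rfl⟩
    exact ⟨j, of_decide_eq_true (List.mem_filter.mp hj).2, rfl⟩
  · rintro ⟨j, hj, rfl⟩
    exact ⟨j, List.mem_filter.mpr ⟨List.mem_finRange j, decide_eq_true hj⟩, rfl⟩

theorem nodup_termData_fst {e : ℕ} {T : Fin e → SPExpr G K} (hT : Function.Injective T)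
    (m : Fin e → ℤ) : ((termData T m).map Prod.fst).Nodup := by
  rw [termData, List.map_map]
  exact ((List.nodup_finRange e).filter _).map hT

/-- Here distinctness of the T_i enters: each atom determines its index, so the exponents can be
read off the list. -/
theorem eq_of_termData_perm {e : ℕ} {T : Fin e → SPExpr G K} (hT : Function.Injective T)
    {m m' : Fin e → ℤ} (h : (termData T m).Perm (termData T m')) : m = m' := by
  have key : ∀ {m m' : Fin e → ℤ}, (termData T m).Perm (termData T m') →
      ∀ j, m j ≠ 0 → m j = m' j := by
    intro m m' h j hj
    obtain ⟨j', -, hjj⟩ := mem_termData.mp (h.mem_iff.mp (mem_termData.mpr ⟨j, hj, rfl⟩))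
    obtain ⟨h1, h2⟩ := Prod.mk.inj hjj
    rw [h2, hT h1]
  ext j
  by_cases h0 : m j = 0
  · by_cases h1 : m' j = 0
    · rw [h0, h1]
    · exact (key h.symm j h1).symm
  · exact key h j h0

theorem exists_perm_termData {e : ℕ} {T : Fin e → SPExpr G K} (hT : Function.Injective T)
    {y : List (SPExpr G K × ℤ)} (hy : ∀ p ∈ y, p.1 ∈ Set.range T ∧ p.2 ≠ 0)
    (hnd : (y.map Prod.fst).Nodup) : ∃ m : Fin e → ℤ, y.Perm (termData T m) := by
  classical
  -- The exponent 0 encodes that `T j` is absent from the list.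
  have hex : ∀ j, ∃ z : ℤ, ∀ z', (T j, z') ∈ y ↔ z' = z ∧ z ≠ 0 := by
    intro j
    by_cases h : ∃ z, (T j, z) ∈ y
    · obtain ⟨z, hz⟩ := h
      refine ⟨z, fun z' => ⟨fun hz' => ?_, ?_⟩⟩
      · exact ⟨congrArg Prod.snd (List.inj_on_of_nodup_map hnd hz' hz rfl), (hy _ hz).2⟩
      · rintro ⟨rfl, -⟩; exact hz
    · exact ⟨0, fun z' => ⟨fun hz' => absurd ⟨z', hz'⟩ h, fun h => absurd rfl h.2⟩⟩
  choose m hm using hex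
  refine ⟨m, (List.perm_ext_iff_of_nodup (List.Nodup.of_map _ hnd)
    (List.Nodup.of_map _ (nodup_termData_fst hT m))).mpr ?_⟩
  rintro ⟨a, z⟩
  rw [mem_termData]
  constructor
  · intro h
    obtain ⟨j, hj⟩ := (hy _ h).1
    change T j = a at hj
    subst hj
    obtain ⟨rfl, h0⟩ := (hm j z).mp h
    exact ⟨j, h0, rfl⟩
  · rintro ⟨j, h0, hj⟩
    rw [hj, hm]
    exact ⟨rfl, h0⟩

end DataPerm

end SPExpr

namespace APSExtension

variable {kd : GroundKind} {K : Type*} [Field K] {v : ℕ} {q : Fin v → Kˣ}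
  {E : Type*} [CommRing E] [Algebra (GroundField kd K v) E] {e : ℕ}
  (X : APSExtension (groundShift kd q) E e) (l : Fin e → ℕ)

open SPExpr

/-! ### The induced expressions -/

/-- The data of the expression induced by the reduced representation of `f`. -/
def repData (T : Fin e → SPExpr (GroundField kd K v) K) (f : E) :
    List (GroundField kd K v × List (SPExpr (GroundField kd K v) K × ℤ)) :=
  (X.reducedRep f).support.toList.map fun m => (X.reducedRep f m, termData T m)

theorem exprWith_eq_ofData (T : Fin e → SPExpr (GroundField kd K v) K) (f : E) :
    X.exprWith T f = ofData (X.repData T f) := rfl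

theorem exprWith_truncate {i : Fin e} {f : E} (hf : f ∈ X.tower i.castSucc) :
    X.exprWith (fun j => if _h : j < i then X.exprMonomial l j else .elem 1) f =
      X.exprWith (X.exprMonomial l) f := by
  rw [exprWith_eq_ofData, exprWith_eq_ofData]
  congr 1
  refine List.map_congr_left fun m hm => ?_
  have hm := X.support_reducedRep_subset hf m (Finset.mem_toList.mp hm)
  congr 1
  refine List.map_congr_left fun j hj => ?_
  have hj : m j ≠ 0 := by simpa using (List.mem_filter.mp hj).2
  have : j < i := by
    by_contra h
    exact hj (hm.2 j (Fin.castSucc_le_castSucc_iff.mpr (not_lt.mp h)))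
  simp only [dif_pos this]

theorem exprMonomial_root {i : Fin e} {ν : ℕ} (hi : X.kind i = .A ν) :
    X.exprMonomial l i = .rpow (toBase (kd := kd) (v := v) (X.α i)) := by
  rw [exprMonomial]
  simp only [hi]

theorem exprMonomial_prod {i : Fin e} (hi : X.kind i = .P) :
    X.exprMonomial l i =
      .prod (l i) (X.exprWith (X.exprMonomial l) (X.shift.symm (X.α i))) := by
  rw [exprMonomial]
  simp only [hi]
  rw [X.exprWith_truncate l (X.symm_shiftQuotient_mem i)]

theorem exprMonomial_sum {i : Fin e} (hi : X.kind i = .S) :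
    X.exprMonomial l i =
      .sum (l i) (X.exprWith (X.exprMonomial l) (X.shift.symm (X.β i))) := by
  rw [exprMonomial]
  simp only [hi]
  rw [X.exprWith_truncate l (X.symm_shiftDifference_mem i)]

theorem eval_exprWith (T : Fin e → SPExpr (GroundField kd K v) K) (f : E) (n : ℕ) :
    (X.exprWith T f).eval kd q n = X.evWith (fun j k => (T j).eval kd q k) f n := by
  rw [exprWith_eq_ofData, eval_ofData, repData, List.map_map]
  have key : ∀ m : Fin e → ℤ, ((termData T m).map fun y => eval kd q y.1 n ^ y.2).prod =
      ∏ j, (T j).eval kd q n ^ m j := by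
    intro m
    rw [termData, List.map_map, ← List.ofFn_id, ← List.prod_ofFn]
    have : ∀ L : List (Fin e), ((L.filter fun j => decide (m j ≠ 0)).map
        ((fun y : SPExpr (GroundField kd K v) K × ℤ => eval kd q y.1 n ^ y.2) ∘
          fun j => (T j, m j))).prod = (L.map fun j => (T j).eval kd q n ^ m j).prod := by
      intro L
      induction L with
      | nil => rfl
      | cons j L ih =>
        by_cases h0 : m j = 0
        · rw [List.filter_cons_of_neg (by simpa using h0), ih, List.map_cons, List.prod_cons, h0,
            zpow_zero, one_mul]
        · rw [List.filter_cons_of_pos (by simpa using h0), List.map_cons, List.prod_cons, ih,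
            List.map_cons, List.prod_cons]
          rfl
    rw [this, List.map_ofFn]
    rfl
  rw [evWith, Finsupp.sum, Finset.sum_map_toList]
  refine Finset.sum_congr rfl fun m _ => ?_
  rw [Function.comp_apply, key]

variable {X l}

/-- Expressions and evaluations follow the same recursion, so the values agree for every `n`, as
they must inside sums and products that start at `l i`. -/
theorem eval_exprMonomial (hX : X.IsBasic) (hl : X.IsLowerBounds l) (i : Fin e) (n : ℕ) :
    (X.exprMonomial l i).eval kd q n = X.evMonomial l i n := by
  induction i using WellFoundedLT.induction generalizing n with | _ i ih
  have key : ∀ f ∈ X.tower i.castSucc, ∀ n,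
      (X.exprWith (X.exprMonomial l) f).eval kd q n = X.ev l f n := by
    intro f hf n
    rw [eval_exprWith]
    exact X.evWith_congr hf fun j hj => ih j (Fin.castSucc_lt_castSucc_iff.mp hj) n
  rcases h : X.kind i with ν | _ | _
  · rw [X.exprMonomial_root l h, evMonomial_root hX hl h]
    rfl
  · rw [X.exprMonomial_prod l h, X.evMonomial_eq_prod l (by rw [h]; simp), SPExpr.eval]
    exact Finset.prod_congr rfl fun k _ => key _ (X.symm_shiftQuotient_mem i) k
  · rw [X.exprMonomial_sum l h, X.evMonomial_eq_sum l h, SPExpr.eval]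
    exact Finset.sum_congr rfl fun k _ => key _ (X.symm_shiftDifference_mem i) k

theorem eval_ofData_repData (hX : X.IsBasic) (hl : X.IsLowerBounds l) (f : E) (n : ℕ) :
    (ofData (X.repData (X.exprMonomial l) f)).eval kd q n = X.ev l f n := by
  rw [← exprWith_eq_ofData, eval_exprWith, ev]
  congr 1
  funext j k
  exact eval_exprMonomial hX hl j k

theorem toBase_mem_roots (hX : X.IsBasic) {i : Fin e} {ν : ℕ} (hi : X.kind i = .A ν) :
    toBase (kd := kd) (K := K) (v := v) (X.α i) ∈ nontrivialRootsOfUnity K ∧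
      orderOf (toBase (kd := kd) (K := K) (v := v) (X.α i)) = ν := by
  obtain ⟨c, hα, hpr, -⟩ := exists_base_eq hX hi
  have hc := X.compatible i
  rw [hi] at hc
  rw [hα, toBase_algebraMap X]
  exact ⟨⟨hpr.ne_one hc.1, ν, hc.1.le, hpr.pow_eq_one⟩, hpr.eq_orderOf.symm⟩

/-- The reduced representation of σ⁻¹(α_i) is a single term, so the induced expression contains no
`⊕` and has the shape required inside `Prod`. -/
theorem exists_exprWith_eq_mul (hX : X.IsBasic) (hl : X.IsLowerBounds l) {i : Fin e}
    (hi : X.kind i = .P) : ∃ (f : GroundField kd K v) (p : SPExpr (GroundField kd K v) K),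
      X.exprWith (X.exprMonomial l) (X.shift.symm (X.α i)) = mul (elem f) p ∧
      IsProdStar kd q p ∧ f ≠ 0 ∧ groundZ kd q f ≤ l i := by
  induction i using WellFoundedLT.induction with | _ i ih
  obtain ⟨h, m, hh, hm, -, -, hrep⟩ := hX.exists_reducedRep_eq hi
  have hZ := groundZ_le hl hi (m := m) (by rw [hrep]; simpa using hh)
  rw [hrep, Finsupp.single_eq_same] at hZ
  refine ⟨h, mulList ((termData (X.exprMonomial l) m).map fun y => pow y.1 y.2), ?_, ?_, hh, hZ⟩
  · rw [exprWith_eq_ofData, repData, hrep, Finsupp.support_single _ hh,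
      Finset.toList_singleton, List.map_singleton, Finsupp.single_eq_same]
    rfl
  · refine mulList_induction IsProdStar.one IsProdStar.mul _ fun a ha => ?_
    obtain ⟨y, hy, rfl⟩ := List.mem_map.mp ha
    obtain ⟨j, hj, rfl⟩ := mem_termData.mp hy
    refine IsProdStar.pow _ _ ?_ hj
    obtain ⟨hji, hjP⟩ := hm j hj
    obtain ⟨f, p, hfp, hp, hf, hlf⟩ := ih j hji hjP
    change IsProdStar kd q (X.exprMonomial l j)
    rw [X.exprMonomial_prod l hjP, hfp]
    exact IsProdStar.prod _ f p hp hf hlf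

theorem isProdStar_exprMonomial (hX : X.IsBasic) (hl : X.IsLowerBounds l) {i : Fin e}
    (hi : X.kind i ≠ .S) : IsProdStar kd q (X.exprMonomial l i) := by
  rcases h : X.kind i with ν | _ | _
  · rw [X.exprMonomial_root l h]
    exact IsProdStar.rpow _ (toBase_mem_roots hX h).1
  · obtain ⟨f, p, hfp, hp, hf, hlf⟩ := exists_exprWith_eq_mul hX hl h
    rw [X.exprMonomial_prod l h, hfp]
    exact IsProdStar.prod _ f p hp hf hlf
  · exact absurd h hi

theorem isSumProd_exprWith (hX : X.IsBasic) (hl : X.IsLowerBounds l) {i : Fin (e + 1)} {f : E}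
    (hf : f ∈ X.tower i)
    (ih : ∀ j : Fin e, j.castSucc < i → IsSumProd kd q (X.exprMonomial l j)) :
    IsSumProd kd q (X.exprWith (X.exprMonomial l) f) := by
  refine addList_induction (IsSumProd.elem 0) IsSumProd.add _ fun a ha => ?_
  obtain ⟨x, hx, rfl⟩ := List.mem_map.mp ha
  obtain ⟨m, hm, rfl⟩ := List.mem_map.mp hx
  have hm := X.support_reducedRep_subset hf m (Finset.mem_toList.mp hm)
  refine IsSumProd.mul _ _ (IsSumProd.elem _) ?_
  refine mulList_induction (IsSumProd.elem 1) IsSumProd.mul _ fun b hb => ?_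
  obtain ⟨y, hy, rfl⟩ := List.mem_map.mp hb
  obtain ⟨j, hj, rfl⟩ := mem_termData.mp hy
  by_cases hS : X.kind j = .S
  · have h0 := hm.1 j
    rw [hS] at h0
    have h0 : 0 ≤ m j := h0
    refine IsSumProd.pow _ _ (ih j ?_) (by change 1 ≤ m j; omega)
    by_contra hji
    exact hj (hm.2 j (not_lt.mp hji))
  · exact IsSumProd.prodStar _ (IsProdStar.pow _ _ (isProdStar_exprMonomial hX hl hS) hj)

theorem isSumProd_exprMonomial (hX : X.IsBasic) (hl : X.IsLowerBounds l) (i : Fin e) :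
    IsSumProd kd q (X.exprMonomial l i) := by
  induction i using WellFoundedLT.induction with | _ i ih
  by_cases hS : X.kind i = .S
  · rw [X.exprMonomial_sum l hS]
    exact IsSumProd.sum _ _ (isSumProd_exprWith hX hl (X.symm_shiftDifference_mem i)
      fun j hj => ih j (Fin.castSucc_lt_castSucc_iff.mp hj))
  · exact IsSumProd.prodStar _ (isProdStar_exprMonomial hX hl hS)

theorem isSigmaPi_exprMonomial (hX : X.IsBasic) (hl : X.IsLowerBounds l) (i : Fin e) :
    IsSigmaPi kd q (X.exprMonomial l i) := by
  rcases h : X.kind i with ν | _ | _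
  · rw [X.exprMonomial_root l h]
    exact (toBase_mem_roots hX h).1
  · rw [X.exprMonomial_prod l h]
    exact exists_exprWith_eq_mul hX hl h
  · rw [X.exprMonomial_sum l h]
    exact isSumProd_exprWith hX hl (X.symm_shiftDifference_mem i)
      fun j _ => isSumProd_exprMonomial hX hl j

theorem allowedExponent_iff (hX : X.IsBasic) (i : Fin e) (z : ℤ) :
    AllowedExponent kd (X.exprMonomial l i) z ↔ z ∈ (X.kind i).exponents ∧ z ≠ 0 := by
  rcases h : X.kind i with ν | _ | _
  · rw [X.exprMonomial_root l h]
    change 1 ≤ z ∧ z < _ ↔ (0 ≤ z ∧ z < _) ∧ z ≠ 0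
    rw [(toBase_mem_roots hX h).2]
    omega
  · rw [X.exprMonomial_prod l h]
    exact ⟨fun h => ⟨trivial, h⟩, fun h => h.2⟩
  · rw [X.exprMonomial_sum l h]
    change 1 ≤ z ↔ 0 ≤ z ∧ z ≠ 0
    omega

/-! ### Reduced expressions and ring elements -/

theorem isReducedData_repData (hX : X.IsBasic) (hl : X.IsLowerBounds l)
    (hT : Function.Injective (X.exprMonomial l)) (f : E) :
    IsReducedData kd q (Set.range (X.exprMonomial l)) (X.repData (X.exprMonomial l) f) := by
  constructor
  · intro x hx
    obtain ⟨m, hm, rfl⟩ := List.mem_map.mp hx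
    have hm := Finset.mem_toList.mp hm
    refine ⟨Finsupp.mem_support_iff.mp hm, fun y hy => ?_, nodup_termData_fst hT m⟩
    obtain ⟨j, hj, rfl⟩ := mem_termData.mp hy
    exact ⟨⟨j, rfl⟩, isSigmaPi_exprMonomial hX hl j,
      (allowedExponent_iff hX j _).mpr ⟨X.exponents_of_mem_support hm j, hj⟩⟩
  · rw [repData, List.pairwise_map]
    exact (Finset.nodup_toList _).imp fun hne h => hne (eq_of_termData_perm hT h)

/-- The converse of `isReducedData_repData`: every summand determines an exponent vector, distinct
summands determine distinct ones, and the coefficients at these vectors form a reduced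
representation. -/
theorem exists_dataPerm_repData (hX : X.IsBasic) (hT : Function.Injective (X.exprMonomial l))
    {D : List (GroundField kd K v × List (SPExpr (GroundField kd K v) K × ℤ))}
    (hD : IsReducedData kd q (Set.range (X.exprMonomial l)) D) :
    ∃ f : E, DataPerm D (X.repData (X.exprMonomial l) f) := by
  classical
  set T := X.exprMonomial l with hTdef
  have hex : ∀ x : GroundField kd K v × List (SPExpr (GroundField kd K v) K × ℤ),
      ∃ m : Fin e → ℤ, x ∈ D → x.2.Perm (termData T m) := by
    intro x
    by_cases hx : x ∈ D
    · obtain ⟨-, h2, h3⟩ := hD.1 x hx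
      obtain ⟨m, hm⟩ := exists_perm_termData hT (y := x.2) (fun p hp => by
        obtain ⟨⟨j, hj⟩, -, ha⟩ := h2 p hp
        rw [← hj] at ha
        exact ⟨⟨j, hj⟩, ((allowedExponent_iff hX j _).mp ha).2⟩) h3
      exact ⟨m, fun _ => hm⟩
    · exact ⟨0, fun h => absurd h hx⟩
  choose μ hμ using hex
  -- Equal exponent vectors would make two power products agree up to a permutation, which
  -- reducedness excludes; so no coefficients are merged in `c` below.
  have hinj : ∀ x ∈ D, ∀ x' ∈ D, μ x = μ x' → x = x' := by
    intro x hx x' hx' hxx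
    by_contra hne
    have : Std.Symm fun x x' : GroundField kd K v × List (SPExpr (GroundField kd K v) K × ℤ) =>
      ¬ x.2.Perm x'.2 := ⟨fun _ _ h h' => h h'.symm⟩
    have hp := hD.2.forall hx hx' hne
    refine hp ((hμ x hx).trans ?_)
    rw [hxx]
    exact (hμ x' hx').symm
  have hDnd : D.Nodup := hD.2.imp fun h hxx => h (by rw [hxx])
  set c : (Fin e → ℤ) →₀ GroundField kd K v := ∑ x ∈ D.toFinset, Finsupp.single (μ x) x.1 with hc
  have hcx : ∀ x ∈ D, c (μ x) = x.1 := by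
    intro x hx
    rw [hc, Finsupp.finsetSum_apply, Finset.sum_eq_single_of_mem x (List.mem_toFinset.mpr hx)]
    · rw [Finsupp.single_eq_same]
    · intro x' hx' hne
      rw [Finsupp.single_apply, if_neg]
      exact fun h => hne (hinj _ (List.mem_toFinset.mp hx') _ hx h)
  have hsupp : ∀ m, m ∈ c.support ↔ m ∈ D.map μ := by
    intro m
    rw [List.mem_map]
    constructor
    · intro hm
      obtain ⟨x, hx, hmx⟩ := Finset.mem_biUnion.mp (Finsupp.support_finsetSum hm)
      exact ⟨x, List.mem_toFinset.mp hx,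
        (Finset.mem_singleton.mp (Finsupp.support_single_subset hmx)).symm⟩
    · rintro ⟨x, hx, rfl⟩
      rw [Finsupp.mem_support_iff, hcx x hx]
      exact (hD.1 x hx).1
  obtain ⟨f, hrep⟩ : ∃ f, X.reducedRep f = c := by
    refine ⟨c.sum fun m a => algebraMap (GroundField kd K v) E a *
      ∏ i, ringZPow (X.t i) (m i), IsReducedRep.reducedRep_eq ⟨fun m hm i => ?_, rfl⟩⟩
    obtain ⟨x, hx, rfl⟩ := List.mem_map.mp ((hsupp m).mp hm)
    by_cases h0 : μ x i = 0
    · rw [h0]; exact (X.compatible i).zero_mem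
    · have hy := (hμ x hx).mem_iff.mpr (mem_termData.mpr ⟨i, h0, rfl⟩)
      exact ((allowedExponent_iff hX i _).mp ((hD.1 x hx).2.1 _ hy).2.2).1
  refine ⟨f, dataPerm_of_forall₂_of_perm (D' := D.map fun x => (c (μ x), termData T (μ x))) ?_ ?_⟩
  · rw [List.forall₂_map_right_iff, List.forall₂_same]
    exact fun x hx => ⟨(hcx x hx).symm, hμ x hx⟩
  · rw [repData, hrep]
    have : (D.map μ).Perm c.support.toList := by
      refine (List.perm_ext_iff_of_nodup ?_ (Finset.nodup_toList _)).mpr fun m => ?_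
      · exact hDnd.map_on hinj
      · rw [Finset.mem_toList, hsupp]
    have h2 := this.map fun m => (c m, termData T m)
    rwa [List.map_map] at h2

/-! ### Algebraic independence of the monomials -/

section AlgIndep

variable {G : Type*} [Field G] {σ₀ : G ≃+* G} {E : Type*} [CommRing E] [Algebra G E] {e : ℕ}
  (X : APSExtension σ₀ E e)

/-- The ring generated by `G` and the `A`-monomials. -/
def rootSubring : Subring E :=
  Subring.closure (Set.range (algebraMap G E) ∪ {s | ∃ i ν, X.kind i = .A ν ∧ s = X.t i})

/-- The exponent vectors in which only `A`-monomials occur. -/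
def rootExponents : Set (Fin e → ℤ) :=
  {m | m ∈ X.exponentVectors ∧ ∀ i, (∀ ν, X.kind i ≠ .A ν) → m i = 0}

/-- The span is closed under multiplication because exponents of `A`-monomials add modulo their
orders while all other exponents stay 0. -/
theorem mem_span_of_mem_rootSubring {f : E} (hf : f ∈ X.rootSubring) :
    f ∈ Submodule.span G (powerProduct X.t '' X.rootExponents) := by
  classical
  have hS0 : (0 : Fin e → ℤ) ∈ X.rootExponents :=
    ⟨fun i => (X.compatible i).zero_mem, fun _ _ => rfl⟩
  have hbase : ∀ a : G,
      algebraMap G E a ∈ Submodule.span G (powerProduct X.t '' X.rootExponents) := by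
    intro a
    rw [Algebra.algebraMap_eq_smul_one]
    exact Submodule.smul_mem _ _ (Submodule.subset_span ⟨0, hS0, powerProduct_zero _⟩)
  induction hf using Subring.closure_induction with
  | mem x hx =>
    rcases hx with ⟨a, rfl⟩ | ⟨i, ν, hi, rfl⟩
    · exact hbase a
    · refine Submodule.subset_span ⟨Function.update 0 i 1,
        ⟨X.exponents_single (X.compatible i).one_mem, fun j hj => ?_⟩, ?_⟩
      · have : j ≠ i := by rintro rfl; exact hj ν hi
        rw [Function.update_of_ne this, Pi.zero_apply]
      · rw [powerProduct_single, ringZPow_one]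
  | zero => exact zero_mem _
  | one => simpa using hbase 1
  | add x y _ _ hx hy => exact add_mem hx hy
  | neg x _ hx => exact neg_mem hx
  | mul x y hx' hy' hx hy =>
    clear hx' hy'
    induction hx, hy using Submodule.span_induction₂ with
    | mem_mem x y hx hy =>
      obtain ⟨m, hm, rfl⟩ := hx
      obtain ⟨m', hm', rfl⟩ := hy
      refine Submodule.subset_span ⟨(X.redAdd ⟨m, hm.1⟩ ⟨m', hm'.1⟩).1,
        ⟨(X.redAdd _ _).2, fun i hi => ?_⟩, X.powerProduct_redAdd X.compatible _ _⟩
      change (X.kind i).red (m i + m' i) = 0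
      rw [hm.2 i hi, hm'.2 i hi]
      rcases h : X.kind i with ν | _ | _
      · exact absurd h (hi ν)
      · rfl
      · rfl
    | zero_left y _ => rw [zero_mul]; exact zero_mem _
    | zero_right x _ => rw [mul_zero]; exact zero_mem _
    | add_left x y z _ _ _ hx hy => rw [add_mul]; exact add_mem hx hy
    | add_right x y z _ _ _ hx hy => rw [mul_add]; exact add_mem hx hy
    | smul_left r x y _ _ h => rw [smul_mul_assoc]; exact Submodule.smul_mem _ _ h
    | smul_right r x y _ _ h => rw [mul_smul_comm]; exact Submodule.smul_mem _ _ h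

open Classical in
/-- The power products of the `P`- and `S`-monomials are linearly independent over the ring
generated by `G` and the `A`-monomials. -/
theorem eq_zero_of_sum_monomials_eq_zero
    (s : Finset ({i : Fin e // ∀ ν, X.kind i ≠ .A ν} →₀ ℕ))
    (c : ({i : Fin e // ∀ ν, X.kind i ≠ .A ν} →₀ ℕ) → E) (hc : ∀ u, c u ∈ X.rootSubring)
    (h0 : ∑ u ∈ s, c u * ∏ i, X.t i.1 ^ u i = 0) : ∀ u ∈ s, c u = 0 := by
  have hrep : ∀ u, ∃ a : (Fin e → ℤ) →₀ G, (∀ m ∈ a.support, m ∈ X.rootExponents) ∧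
      c u = ∑ m ∈ a.support, algebraMap G E (a m) * powerProduct X.t m := by
    intro u
    obtain ⟨a, ha, hac⟩ := (Finsupp.mem_span_image_iff_linearCombination G).mp
      (X.mem_span_of_mem_rootSubring (hc u))
    refine ⟨a, fun m hm => ha hm, ?_⟩
    rw [← hac, Finsupp.linearCombination_apply]
    exact Finset.sum_congr rfl fun m _ => Algebra.smul_def _ _
  choose a ha hac using hrep
  -- the exponent vector with `A`-part `m` and `P`- and `S`-part `u`
  let join : ({i : Fin e // ∀ ν, X.kind i ≠ .A ν} →₀ ℕ) → (Fin e → ℤ) → Fin e → ℤ :=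
    fun u m i => if h : ∀ ν, X.kind i ≠ .A ν then (u ⟨i, h⟩ : ℤ) else m i
  have hjoin : ∀ u, ∀ m ∈ X.rootExponents, powerProduct X.t (join u m) =
      powerProduct X.t m * ∏ i, X.t i.1 ^ u i := by
    intro u m hm
    have h1 : ∏ i : {i : Fin e // ∀ ν, X.kind i ≠ .A ν}, X.t i.1 ^ u i =
        ∏ i : Fin e, if h : ∀ ν, X.kind i ≠ .A ν then X.t i ^ u ⟨i, h⟩ else 1 := by
      rw [Fintype.prod_dite]
      simp
    rw [h1, powerProduct, powerProduct, ← Finset.prod_mul_distrib]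
    refine Finset.prod_congr rfl fun i _ => ?_
    by_cases h : ∀ ν, X.kind i ≠ .A ν
    · simp only [join, dif_pos h]
      rw [hm.2 i h, ringZPow_zero, one_mul, ringZPow_natCast]
    · simp only [join, dif_neg h, mul_one]
  have hjoin_mem : ∀ u, ∀ m ∈ X.rootExponents, join u m ∈ X.exponentVectors := by
    intro u m hm i
    by_cases h : ∀ ν, X.kind i ≠ .A ν
    · simp only [join, dif_pos h]
      rcases hk : X.kind i with ν | _ | _
      · exact absurd hk (h ν)
      · trivial
      · exact Int.natCast_nonneg _
    · simp only [join, dif_neg h]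
      exact hm.1 i
  have hinj : ∀ u, ∀ m ∈ X.rootExponents, ∀ u', ∀ m' ∈ X.rootExponents,
      join u m = join u' m' → u = u' ∧ m = m' := by
    intro u m hm u' m' hm' h
    constructor
    · ext ⟨i, hi⟩
      have := congrFun h i
      simp only [join, dif_pos hi] at this
      exact_mod_cast this
    · ext i
      by_cases hi : ∀ ν, X.kind i ≠ .A ν
      · rw [hm.2 i hi, hm'.2 i hi]
      · have := congrFun h i
        simpa only [join, dif_neg hi] using this
  -- Expanding the coefficients `c u` turns the relation into a `G`-linear relation among the basis
  -- elements with exponents `join u m`, which are pairwise distinct.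
  have hli := X.powerBasis.linearIndependent
  set I := s.sigma fun u => (a u).support with hI
  have hmem : ∀ p ∈ I, p.2 ∈ X.rootExponents := fun p hp =>
    ha _ _ (Finset.mem_sigma.mp hp).2
  have hsum : ∑ p : I, a p.1.1 p.1.2 •
      X.powerBasis ⟨join p.1.1 p.1.2, hjoin_mem _ _ (hmem p.1 p.2)⟩ = 0 := by
    rw [← h0]
    simp only [X.powerBasis_apply]
    rw [Finset.sum_coe_sort I fun p => a p.1 p.2 • powerProduct X.t (join p.1 p.2), hI,
      Finset.sum_sigma]
    refine Finset.sum_congr rfl fun u _ => ?_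
    rw [hac u, Finset.sum_mul]
    refine Finset.sum_congr rfl fun m hm => ?_
    rw [hjoin u m (ha u m hm), Algebra.smul_def, mul_assoc]
  have hli' := hli.comp
    (fun p : I => ⟨join p.1.1 p.1.2, hjoin_mem _ _ (hmem p.1 p.2)⟩) (by
      rintro ⟨⟨u, m⟩, hp⟩ ⟨⟨u', m'⟩, hp'⟩ h
      obtain ⟨rfl, rfl⟩ := hinj _ _ (hmem _ hp) _ _ (hmem _ hp') (congrArg Subtype.val h)
      rfl)
  have hzero := Fintype.linearIndependent_iff.mp hli' (fun p => a p.1.1 p.1.2) hsum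
  intro u hu
  rw [hac u]
  refine Finset.sum_eq_zero fun m hm => ?_
  have := hzero ⟨⟨u, m⟩, Finset.mem_sigma.mpr ⟨hu, hm⟩⟩
  exact absurd this (Finsupp.mem_support_iff.mp hm)

end AlgIndep

/-! ### Injectivity of τ and the equivalent statements -/

variable {kd : GroundKind} {K : Type*} [Field K] {v : ℕ} {q : Fin v → Kˣ}
  {E : Type*} [CommRing E] [Algebra (GroundField kd K v) E] {e : ℕ}
  {X : APSExtension (groundShift kd q) E e} {l : Fin e → ℕ}

open SPExpr

/-- The coefficients of a relation lift to elements of `rootSubring`; injectivity lifts the relation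
itself to `E`, where the basis of power products makes it trivial. -/
theorem monomialsAlgIndep_of_injective (Φ : E →+* SeqRing K) (hΦ : ∀ f, Φ f = X.tau l f)
    (hinj : Function.Injective Φ) : X.MonomialsAlgIndep l := by
  have hroot : X.rootRing l = X.rootSubring.map Φ := by
    rw [rootRing, rootSubring, RingHom.map_closure]
    congr 1
    rw [Set.image_union, ← Set.range_comp]
    congr 1
    · exact congrArg Set.range (funext fun g => (hΦ _).symm)
    · ext s
      constructor
      · rintro ⟨i, ν, hi, rfl⟩
        exact ⟨X.t i, ⟨i, ν, hi, rfl⟩, hΦ _⟩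
      · rintro ⟨_, ⟨i, ν, hi, rfl⟩, rfl⟩
        exact ⟨i, ν, hi, hΦ _⟩
  rw [MonomialsAlgIndep, algebraicIndependent_iff]
  intro p hp
  classical
  have hex : ∀ u, ∃ c ∈ X.rootSubring, Φ c = ((p.coeff u : X.rootRing l) : SeqRing K) := by
    intro u
    have : ((p.coeff u : X.rootRing l) : SeqRing K) ∈ X.rootSubring.map Φ := hroot ▸ (p.coeff u).2
    exact this
  choose c hc hcp using hex
  have h0 := X.eq_zero_of_sum_monomials_eq_zero p.support c hc (hinj (by
    rw [map_zero, ← hp, MvPolynomial.aeval_def, MvPolynomial.eval₂_eq', map_sum]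
    refine Finset.sum_congr rfl fun u _ => ?_
    rw [map_mul, map_prod, hcp]
    congr 1
    refine Finset.prod_congr rfl fun i _ => ?_
    rw [map_pow, hΦ]))
  by_contra hne
  obtain ⟨u, hu⟩ := MvPolynomial.support_nonempty.mpr hne
  refine MvPolynomial.mem_support_iff.mp hu (Subtype.ext ?_)
  rw [← hcp, h0 u hu, map_zero]
  rfl

theorem tauIsKIso_of_injective (Φ : E →+* SeqRing K) (hΦ : ∀ f, Φ f = X.tau l f)
    (hσ : ∀ f, Φ (X.shift f) = seqShift (Φ f))
    (hK : ∀ c : K, Φ (algebraMap _ E (algebraMap K (GroundField kd K v) c)) =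
      ((fun _ => c : ℕ → K) : SeqRing K)) (hinj : Function.Injective Φ) : X.TauIsKIso l := by
  have hcoe : ∀ f, (RingEquiv.ofBijective Φ.rangeRestrict
      ⟨fun a b h => hinj (congrArg Subtype.val h), Φ.rangeRestrict_surjective⟩ f : SeqRing K) =
      Φ f := fun f => rfl
  refine ⟨Φ.range, RingEquiv.ofBijective Φ.rangeRestrict
      ⟨fun a b h => hinj (congrArg Subtype.val h), Φ.rangeRestrict_surjective⟩, ?_, ?_, ?_, ?_⟩
  · rw [RingHom.coe_range]
    exact congrArg Set.range (funext hΦ)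
  · intro f; rw [hcoe, hΦ]
  · intro f; rw [hcoe, hcoe, hσ]
  · intro c; rw [hcoe, hK]

/-- If `τ` is injective, then there are no new constants. -/
theorem isRPiSigma_of_injective (Φ : E →+* SeqRing K)
    (hσ : ∀ f, Φ (X.shift f) = seqShift (Φ f))
    (hK : ∀ c : K, Φ (algebraMap _ E (algebraMap K (GroundField kd K v) c)) =
      ((fun _ => c : ℕ → K) : SeqRing K)) (hinj : Function.Injective Φ) : X.IsRPiSigma := by
  -- If `g (n + 1) = g n` for all `n ≥ N`, then `g` equals `g N` from `N` on.
  have hconst : ∀ s : SeqRing K, seqShift s = s → ∃ c : K,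
      s = ((fun _ => c : ℕ → K) : SeqRing K) := by
    intro s
    induction s using Filter.Germ.inductionOn with | _ g
    rw [seqShift_coe, Filter.Germ.coe_eq]
    intro h
    obtain ⟨N, hN⟩ := Filter.eventually_atTop.mp h
    refine ⟨g N, Filter.Germ.coe_eq.mpr (Filter.eventually_atTop.mpr ⟨N, fun n hn => ?_⟩)⟩
    induction n, hn using Nat.le_induction with
    | base => rfl
    | succ n hn ih => exact (hN n hn).trans ih
  apply Set.Subset.antisymm
  · intro f hf
    have hf : X.shift f = f := hf
    obtain ⟨c, hc⟩ := hconst (Φ f) (by rw [← hσ, hf])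
    have hfc := hinj (hc.trans (hK c).symm)
    refine ⟨algebraMap K _ c, ?_, hfc.symm⟩
    apply X.algebraMap_injective
    rw [← X.shift_algebraMap, ← hfc, hf]
  · rintro _ ⟨a, ha, rfl⟩
    have ha : groundShift kd q a = a := ha
    change X.shift _ = _
    rw [X.shift_algebraMap, ha]

/-- Equal expressions have equal values, so injectivity gives `t_i = t_j`, and reduced
representations tell different monomials apart. -/
theorem exprMonomial_injective (hX : X.IsBasic) (hl : X.IsLowerBounds l) (Φ : E →+* SeqRing K)
    (hΦ : ∀ f, Φ f = X.tau l f) (hinj : Function.Injective Φ) :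
    Function.Injective (X.exprMonomial l) := by
  intro i j hij
  have h1 : X.t i = X.t j := by
    apply hinj
    rw [hΦ, hΦ, tau, tau]
    congr 1
    funext n
    rw [X.ev_t, X.ev_t, ← eval_exprMonomial hX hl, ← eval_exprMonomial hX hl, hij]
  have h2 := congrArg X.reducedRep h1
  rw [X.reducedRep_t, X.reducedRep_t] at h2
  have h3 := (Finsupp.single_left_injective (one_ne_zero (α := GroundField kd K v))) h2
  by_contra hne
  have h4 := congrFun h3 i
  rw [Function.update_self, Function.update_of_ne hne, Pi.zero_apply] at h4
  exact one_ne_zero h4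

/-- Both expressions come from elements of `E` up to permutation; eventual agreement makes these
elements equal, and the permutations compose. -/
theorem isCanonicalReduced_of_injective (hX : X.IsBasic) (hl : X.IsLowerBounds l)
    (hT : Function.Injective (X.exprMonomial l)) (Φ : E →+* SeqRing K)
    (hΦ : ∀ f, Φ f = X.tau l f) (hinj : Function.Injective Φ) :
    IsCanonicalReduced kd q (Set.range (X.exprMonomial l)) := by
  rintro _ ⟨D, hD, rfl⟩ _ ⟨D', hD', rfl⟩ ⟨δ, hδ⟩
  obtain ⟨f, hf⟩ := exists_dataPerm_repData hX hT hD
  obtain ⟨g, hg⟩ := exists_dataPerm_repData hX hT hD'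
  have hfg : f = g := by
    apply hinj
    rw [hΦ, hΦ, tau, tau, Filter.Germ.coe_eq]
    refine Filter.eventually_atTop.mpr ⟨δ, fun n hn => ?_⟩
    rw [← eval_ofData_repData hX hl, ← eval_ofData_repData hX hl, ← eval_ofData_eq q hf,
      ← eval_ofData_eq q hg, hδ n hn]
  subst hfg
  exact ⟨D, D', rfl, rfl, hf.trans hg.symm⟩

theorem _root_.SymbolicSummation.SPExpr.IsCanonicalReduced.trivialZeroRecognition
    {W : Set (SPExpr (GroundField kd K v) K)} (h : IsCanonicalReduced kd q W) :
    TrivialZeroRecognition kd q W := by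
  intro F hF
  constructor
  · rintro rfl
    exact ⟨0, fun n _ => groundEval_zero n⟩
  · rintro ⟨δ, hδ⟩
    have h0 : elem 0 ∈ SumProd kd q W := ⟨[], ⟨by simp, List.Pairwise.nil⟩, rfl⟩
    obtain ⟨D, D', rfl, hD', D'', h1, h2⟩ := h F hF (elem 0) h0 ⟨δ, fun n hn =>
      (hδ n hn).trans (groundEval_zero n).symm⟩
    have hD' := eq_nil_of_ofData_eq_elem hD'.symm
    subst hD'
    cases h2
    rw [h1.eq_nil]
    rfl

/-- An element of the kernel induces a reduced expression that is eventually 0, hence the expression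
0, so its reduced representation has empty support. -/
theorem injective_of_trivialZeroRecognition (hX : X.IsBasic) (hl : X.IsLowerBounds l)
    (hT : Function.Injective (X.exprMonomial l)) (Φ : E →+* SeqRing K)
    (hΦ : ∀ f, Φ f = X.tau l f)
    (h : TrivialZeroRecognition kd q (Set.range (X.exprMonomial l))) :
    Function.Injective Φ := by
  rw [injective_iff_map_eq_zero]
  intro f hf
  rw [hΦ, tau, ← Filter.Germ.coe_zero, Filter.Germ.coe_eq] at hf
  obtain ⟨δ, hδ⟩ := Filter.eventually_atTop.mp hf
  have h0 := (h _ ⟨_, isReducedData_repData hX hl hT f, rfl⟩).mpr ⟨δ, fun n hn => by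
    rw [eval_ofData_repData hX hl, hδ n hn]
    rfl⟩
  have h1 := eq_nil_of_ofData_eq_elem h0
  rw [repData, List.map_eq_nil_iff, Finset.toList_eq_nil, Finsupp.support_eq_empty] at h1
  exact X.reducedRep_eq_zero_iff.mp h1

end APSExtension

end SymbolicSummation

end

theorem mainTheorem1 {k K : Type*} [Field k] [Field K] [Algebra k K] {v : ℕ} (q : Fin v → Kˣ)
    (hq : AlgebraicIndependent k (fun i => (q i : K)))
    (hK : IntermediateField.adjoin k (Set.range fun i => (q i : K)) = ⊤)
    (kd : GroundKind) (hchar : kd = .multibasic ∨ CharZero k)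
    {E : Type*} [CommRing E] [Algebra (GroundField kd K v) E] {e : ℕ}
    (X : APSExtension (groundShift kd q) E e) (hX : X.IsBasic)
    (l : Fin e → ℕ) (hl : X.IsLowerBounds l) :
    X.TauIsKHom l ∧
    (∀ i, (X.exprMonomial l i).IsSigmaPi kd q) ∧
    (X.IsRPiSigma ↔ X.TauIsKIso l ∧ X.MonomialsAlgIndep l) ∧
    (X.IsRPiSigma → Function.Injective (X.exprMonomial l)) ∧
    (Function.Injective (X.exprMonomial l) →
      List.TFAE
        [X.IsRPiSigma,
         X.TauIsKIso l ∧ X.MonomialsAlgIndep l,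
         SPExpr.IsCanonicalReduced kd q (Set.range (X.exprMonomial l)),
         SPExpr.TrivialZeroRecognition kd q (Set.range (X.exprMonomial l))]) := by
  have hnz : EventuallyNonzero kd q := exists_forall_polyEval_ne_zero q hq hK kd hchar
  obtain ⟨Φ, hΦ, hσ, hc⟩ := APSExtension.exists_tauHom hnz hX hl
  have h1 : X.IsRPiSigma → Function.Injective Φ := fun h =>
    X.injective_of_isRPiSigma h Φ fun x hx => by
      rw [hσ, hx]
      rfl
  have h2 : X.IsRPiSigma ↔ X.TauIsKIso l ∧ X.MonomialsAlgIndep l := by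
    refine ⟨fun h => ⟨APSExtension.tauIsKIso_of_injective Φ hΦ hσ hc (h1 h),
      APSExtension.monomialsAlgIndep_of_injective Φ hΦ (h1 h)⟩, ?_⟩
    rintro ⟨⟨R, φ, -, hφ, -⟩, -⟩
    refine APSExtension.isRPiSigma_of_injective Φ hσ hc fun a b hab => φ.injective ?_
    apply Subtype.ext
    rw [hφ, hφ, ← hΦ, ← hΦ, hab]
  refine ⟨⟨Φ, hΦ, hσ, hc⟩, APSExtension.isSigmaPi_exprMonomial hX hl, h2,
    fun h => APSExtension.exprMonomial_injective hX hl Φ hΦ (h1 h), fun hT => ?_⟩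
  tfae_have 1 ↔ 2 := h2
  tfae_have 1 → 3 := fun h =>
    APSExtension.isCanonicalReduced_of_injective hX hl hT Φ hΦ (h1 h)
  tfae_have 3 → 4 := fun h => h.trivialZeroRecognition
  tfae_have 4 → 1 := fun h => APSExtension.isRPiSigma_of_injective Φ hσ hc
    (APSExtension.injective_of_trivialZeroRecognition hX hl hT Φ hΦ h)
  tfae_finish
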